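/- Let $0<a<b$, and let $V\in C^\infty(\mathbf R^2)$ be a bounded real-valued function for which there is a constant $V_0>0$ with $$V(x)\ \ge\ \frac{V_0}{1+|x|}\qquad (x\in\mathbf R^2).$$ Let $u_0,u_1\in (C_0^\infty(\mathbf R^2))^2$ satisfy $\operatorname{supp}u_0\cup\operatorname{supp}u_1\subset\{|x|\le L\}$ for some $L>0$, and let $u=(u^{(1)},u^{(2)}):[0,\infty)\times\mathbf R^2\to\mathbf R^2$ be the smooth solution ($C^\infty$ up to $t=0$) of $$u_{tt}-a^2\Delta u-(b^2-a^2)\nabla\operatorname{div}u+V(x)u_t=0\quad (t>0,\ x\in\mathbf R^2),\qquad u(0,x)=u_0(x),\quad u_t(0,x)=u_1(x).$$ Put $|\nabla u|^2=|\nabla u^{(1)}|^2+|\nabla u^{(2)}|^2$ and $$E_u(t)=\frac12\int_{\mathbf R^2}\Big(|u_t(t,x)|^2+a^2|\nabla u(t,x)|^2+(b^2-a^2)(\operatorname{div}u(t,x))^2\Big)\,dx .$$ Then this integral is finite for every $t\ge 0$, and as $t\to\infty$: 1. if $V_0>2b$, then $E_u(t)=O(t^{-2}\log t)$; 2. if $b<V_0\le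 2b$, then $E_u(t)=O(t^{-V_0/b+\delta}\log t)$ for every $\delta>0$. -/

import Mathlib

open Set Filter MeasureTheory
open scoped ContDiff Gradient

noncomputable section

/-- The plane with its Euclidean norm. -/
abbrev Plane : Type := EuclideanSpace ℝ (Fin 2)

/-- The partial derivative `∂_j f_i` of a vector field at `x`. -/
def partialD (f : Plane → Plane) (i j : Fin 2) (x : Plane) : ℝ :=
  fderiv ℝ f x (EuclideanSpace.single j 1) i

/-- The divergence `∂_1 f_1 + ∂_2 f_2`. -/
def divergence (f : Plane → Plane) (x : Plane) : ℝ :=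
  ∑ i, partialD f i i x

/-- `|∇f|² = |∇f_1|² + |∇f_2|²`. -/
def gradNormSq (f : Plane → Plane) (x : Plane) : ℝ :=
  ∑ i, ∑ j, partialD f i j x ^ 2

/-- The time derivative on `[0, ∞)`: one-sided at `t = 0`, the usual one for `t > 0`. -/
def timeDeriv (u : ℝ → Plane → Plane) (t : ℝ) (x : Plane) : Plane :=
  derivWithin (fun s => u s x) (Ici 0) t

/-- `u`, considered on `[0, ∞) × ℝ²`, is a smooth solution of the Cauchy problem
`u_tt - a² Δu - (b² - a²) ∇ div u + V u_t = 0`, `u(0, ·) = u₀`, `u_t(0, ·) = u₁`. -/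
structure IsSmoothSolution (a b : ℝ) (V : Plane → ℝ) (u₀ u₁ : Plane → Plane)
    (u : ℝ → Plane → Plane) : Prop where
  smooth : ContDiffOn ℝ ∞ (fun p : ℝ × Plane => u p.1 p.2) (Ici 0 ×ˢ univ)
  eqn : ∀ t : ℝ, 0 < t → ∀ x : Plane,
    timeDeriv (timeDeriv u) t x - a ^ 2 • Laplacian.laplacian (u t) x
      - (b ^ 2 - a ^ 2) • gradient (divergence (u t)) x + V x • timeDeriv u t x = 0
  init_pos : ∀ x : Plane, u 0 x = u₀ x
  init_vel : ∀ x : Plane, timeDeriv u 0 x = u₁ x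

/-- `|u_t|² + a² |∇u|² + (b² - a²) (div u)²` at `(t, x)`. -/
def energyDensity (a b : ℝ) (u : ℝ → Plane → Plane) (t : ℝ) (x : Plane) : ℝ :=
  ‖timeDeriv u t x‖ ^ 2 + a ^ 2 * gradNormSq (u t) x
    + (b ^ 2 - a ^ 2) * divergence (u t) x ^ 2

/-- The total energy `E_u(t)`. -/
def energy (a b : ℝ) (u : ℝ → Plane → Plane) (t : ℝ) : ℝ :=
  (1 / 2) * ∫ x, energyDensity a b u t x

end

/-! The proof is a multiplier argument closed by a second energy, that of the time primitive.

Speeds are at most `b`, so the solution lives in |x| ≤ L + bt (`ElasticSystem.eq_zero_of_far`).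
There, with κ = (1 + L)/b and μ = V₀/b, the damping satisfies V (t + κ) ≥ μ. Test the equation with
f u_t + g u, where f = (t + κ)^q and g = f'/2. This choice removes the elastic energy from the
balance and gives |u_t|² the coefficient (t + κ)^(q-1) (q - V (t + κ)), which is nonpositive for q ≤
μ. The remaining bad term is at most a multiple of (t + κ)^(q-2) V |u|², hence of V |u|² when q ≤ 2.

That term is absorbed through U = ∫₀ᵗ u ds, which solves the same equation with the time-independent
source F = u₁ + V u₀. The energy of U, corrected by -∫ F·U, dissipates exactly ∫ V |u|². Adding
κ^(q-2) times it gives a nonincreasing functional (`ElasticSystem.integral_functional_le`).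

For q < μ the multiplier part bounds (t + κ)^q E from below (`ElasticSystem.le_multiplierDensity`).
The sign-indefinite ∫ F·U is paid for by the gradient energy of U through a Hardy inequality on a
ball (`integral_sq_div_weight_le`). In the plane its constant grows like the logarithm of the
radius, here L + bt, and this is the source of log t. The rates follow with q = 2 when μ > 2, and
with q slightly below μ otherwise. -/

noncomputable section

/-! ### Calculus on the closed half space t ≥ 0 -/

/-- Closed space-time half space `t ≥ 0`. -/
def halfSpace : Set (ℝ × Plane) := Ici 0 ×ˢ univ

/-- The `j`-th coordinate vector of the plane. -/
def coordVec (j : Fin 2) : Plane := EuclideanSpace.single j 1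

/-- Smooth scalar functions of time `t ≥ 0` and space, up to `t = 0`. -/
def SmoothEvolution (f : ℝ → Plane → ℝ) : Prop :=
  ContDiffOn ℝ ∞ (fun p : ℝ × Plane => f p.1 p.2) halfSpace

/-- Time derivative of a scalar function, one-sided at `t = 0`. -/
def dt (f : ℝ → Plane → ℝ) (t : ℝ) (x : Plane) : ℝ :=
  derivWithin (fun s => f s x) (Ici 0) t

/-- Spatial partial derivative of a scalar function. -/
def dx (j : Fin 2) (f : ℝ → Plane → ℝ) (t : ℝ) (x : Plane) : ℝ :=
  fderiv ℝ (f t) x (coordVec j)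

theorem uniqueDiffOn_halfSpace : UniqueDiffOn ℝ halfSpace :=
  (uniqueDiffOn_Ici 0).prod uniqueDiffOn_univ

theorem mem_halfSpace {t : ℝ} (ht : 0 ≤ t) (x : Plane) : (t, x) ∈ halfSpace :=
  ⟨ht, mem_univ _⟩

/-- Symmetry of second derivatives within a set is used at points of the closure of its interior;
this includes the boundary t = 0. -/
theorem mem_closure_interior_halfSpace {p : ℝ × Plane} (hp : p ∈ halfSpace) :
    p ∈ closure (interior halfSpace) := by
  have h : closure (interior halfSpace) = halfSpace := by
    simp [halfSpace, interior_prod_eq, closure_prod_eq]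
  rwa [h]

/-- Mixed directional derivatives within the half space commute. -/
theorem fderivWithin_fderivWithin_comm {F : ℝ × Plane → ℝ} (hF : ContDiffOn ℝ ∞ F halfSpace)
    {p : ℝ × Plane} (hp : p ∈ halfSpace) (v w : ℝ × Plane) :
    fderivWithin ℝ (fun q => fderivWithin ℝ F halfSpace q w) halfSpace p v =
      fderivWithin ℝ (fun q => fderivWithin ℝ F halfSpace q v) halfSpace p w := by
  have hd : DifferentiableWithinAt ℝ (fderivWithin ℝ F halfSpace) halfSpace p :=
    ((hF.fderivWithin uniqueDiffOn_halfSpace (m := 1) (by norm_cast)).differentiableOn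
      one_ne_zero) p hp
  have key : ∀ v w : ℝ × Plane,
      fderivWithin ℝ (fun q => fderivWithin ℝ F halfSpace q w) halfSpace p v =
        fderivWithin ℝ (fderivWithin ℝ F halfSpace) halfSpace p v w := by
    intro v w
    rw [fderivWithin_clm_apply (uniqueDiffOn_halfSpace p hp) hd
      (differentiableWithinAt_const w)]
    simp
  rw [key, key]
  exact (ContDiffWithinAt.isSymmSndFDerivWithinAt (n := ∞) (hF p hp)
    (by simp only [minSmoothness_of_isRCLikeNormedField]; exact WithTop.coe_le_coe.2 (le_top (a := (2 : ℕ∞))))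
    uniqueDiffOn_halfSpace (mem_closure_interior_halfSpace hp) hp) v w

theorem fderivWithin_apply_congr {G : ℝ × Plane → ℝ} {g : ℝ → Plane → ℝ}
    (h : ∀ p ∈ halfSpace, g p.1 p.2 = G p) {p : ℝ × Plane} (hp : p ∈ halfSpace)
    (v : ℝ × Plane) :
    fderivWithin ℝ (fun q : ℝ × Plane => g q.1 q.2) halfSpace p v =
      fderivWithin ℝ G halfSpace p v := by
  rw [fderivWithin_congr h (h p hp)]

namespace SmoothEvolution

variable {f g : ℝ → Plane → ℝ}

theorem hasFDerivWithinAt (hf : SmoothEvolution f) {t : ℝ} (ht : 0 ≤ t) (x : Plane) :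
    HasFDerivWithinAt (fun p : ℝ × Plane => f p.1 p.2)
      (fderivWithin ℝ (fun p : ℝ × Plane => f p.1 p.2) halfSpace (t, x)) halfSpace (t, x) :=
  ((hf.differentiableOn (by simp)) _ (mem_halfSpace ht x)).hasFDerivWithinAt

theorem hasDerivWithinAt_aux (hf : SmoothEvolution f) {t : ℝ} (ht : 0 ≤ t) (x : Plane) :
    HasDerivWithinAt (fun s => f s x)
      (fderivWithin ℝ (fun p : ℝ × Plane => f p.1 p.2) halfSpace (t, x) (1, 0)) (Ici 0) t := by
  have h : HasDerivWithinAt (fun s : ℝ => (s, x)) ((1 : ℝ), (0 : Plane)) (Ici 0) t :=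
    (hasDerivWithinAt_id t _).prodMk (hasDerivWithinAt_const t _ x)
  exact (hf.hasFDerivWithinAt ht x).comp_hasDerivWithinAt t h
    (fun s hs => mem_halfSpace hs x)

theorem dt_eq (hf : SmoothEvolution f) {t : ℝ} (ht : 0 ≤ t) (x : Plane) :
    dt f t x = fderivWithin ℝ (fun p : ℝ × Plane => f p.1 p.2) halfSpace (t, x) (1, 0) :=
  (hf.hasDerivWithinAt_aux ht x).derivWithin (uniqueDiffOn_Ici 0 t ht)

theorem hasDerivWithinAt (hf : SmoothEvolution f) {t : ℝ} (ht : 0 ≤ t) (x : Plane) :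
    HasDerivWithinAt (fun s => f s x) (dt f t x) (Ici 0) t := by
  rw [hf.dt_eq ht]; exact hf.hasDerivWithinAt_aux ht x

theorem hasDerivAt (hf : SmoothEvolution f) {t : ℝ} (ht : 0 < t) (x : Plane) :
    HasDerivAt (fun s => f s x) (dt f t x) t :=
  (hf.hasDerivWithinAt ht.le x).hasDerivAt (Ici_mem_nhds ht)

theorem contDiff_slice (hf : SmoothEvolution f) {t : ℝ} (ht : 0 ≤ t) : ContDiff ℝ ∞ (f t) := by
  rw [← contDiffOn_univ]
  exact ContDiffOn.comp (f := fun x : Plane => (t, x)) hf (by fun_prop)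
    (fun x _ => mem_halfSpace ht x)

theorem differentiable_slice (hf : SmoothEvolution f) {t : ℝ} (ht : 0 ≤ t) :
    Differentiable ℝ (f t) :=
  (hf.contDiff_slice ht).differentiable (by simp)

theorem continuous_slice (hf : SmoothEvolution f) {t : ℝ} (ht : 0 ≤ t) : Continuous (f t) :=
  (hf.contDiff_slice ht).continuous

theorem fderiv_slice (hf : SmoothEvolution f) {t : ℝ} (ht : 0 ≤ t) (x v : Plane) :
    fderiv ℝ (f t) x v =
      fderivWithin ℝ (fun p : ℝ × Plane => f p.1 p.2) halfSpace (t, x) (0, v) := by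
  have h : HasFDerivWithinAt (fun y : Plane => (t, y))
      (ContinuousLinearMap.inr ℝ ℝ Plane) univ x := (hasFDerivAt_prodMk_right t x).hasFDerivWithinAt
  have := (hf.hasFDerivWithinAt ht x).comp x h (fun y _ => mem_halfSpace ht y)
  rw [hasFDerivWithinAt_univ] at this
  have h2 : fderiv ℝ (f t) x = _ := this.fderiv
  rw [h2]; simp

theorem dx_eq (hf : SmoothEvolution f) (j : Fin 2) {t : ℝ} (ht : 0 ≤ t) (x : Plane) :
    dx j f t x =
      fderivWithin ℝ (fun p : ℝ × Plane => f p.1 p.2) halfSpace (t, x) (0, coordVec j) :=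
  hf.fderiv_slice ht x _

theorem fderivWithin_apply (hf : SmoothEvolution f) (v : ℝ × Plane) :
    ContDiffOn ℝ ∞
      (fun p => fderivWithin ℝ (fun p : ℝ × Plane => f p.1 p.2) halfSpace p v) halfSpace :=
  (ContDiffOn.fderivWithin hf uniqueDiffOn_halfSpace (m := ∞) (by simp)).clm_apply
    contDiffOn_const

protected theorem dt (hf : SmoothEvolution f) : SmoothEvolution (dt f) :=
  (hf.fderivWithin_apply (1, 0)).congr fun p hp => hf.dt_eq hp.1 p.2

protected theorem dx (hf : SmoothEvolution f) (j : Fin 2) : SmoothEvolution (dx j f) :=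
  (hf.fderivWithin_apply (0, coordVec j)).congr fun p hp => hf.dx_eq j hp.1 p.2

theorem dt_dx (hf : SmoothEvolution f) (j : Fin 2) {t : ℝ} (ht : 0 ≤ t) (x : Plane) :
    _root_.dt (_root_.dx j f) t x = _root_.dx j (_root_.dt f) t x := by
  have hp := mem_halfSpace ht x
  rw [(hf.dx j).dt_eq ht, hf.dt.dx_eq j ht]
  refine (fderivWithin_apply_congr (fun p hp => hf.dx_eq j hp.1 p.2) hp _).trans
    (Eq.trans ?_ (fderivWithin_apply_congr (fun p hp => hf.dt_eq hp.1 p.2) hp _).symm)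
  exact fderivWithin_fderivWithin_comm hf hp _ _

theorem add (hf : SmoothEvolution f) (hg : SmoothEvolution g) : SmoothEvolution (f + g) :=
  ContDiffOn.add hf hg

theorem sub (hf : SmoothEvolution f) (hg : SmoothEvolution g) : SmoothEvolution (f - g) :=
  ContDiffOn.sub hf hg

theorem mul (hf : SmoothEvolution f) (hg : SmoothEvolution g) : SmoothEvolution (f * g) :=
  ContDiffOn.mul hf hg

theorem smul (c : ℝ) (hf : SmoothEvolution f) : SmoothEvolution (c • f) :=
  ContDiffOn.const_smul c hf

theorem of_space {φ : Plane → ℝ} (hφ : ContDiff ℝ ∞ φ) : SmoothEvolution (fun _ => φ) :=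
  (hφ.comp contDiff_snd).contDiffOn

theorem of_time {φ : ℝ → ℝ} (hφ : ContDiffOn ℝ ∞ φ (Ici 0)) :
    SmoothEvolution (fun t _ => φ t) :=
  ContDiffOn.comp (f := Prod.fst) hφ contDiff_fst.contDiffOn fun _ hp => hp.1

theorem dt_add (hf : SmoothEvolution f) (hg : SmoothEvolution g) {t : ℝ} (ht : 0 < t)
    (x : Plane) : _root_.dt (f + g) t x = _root_.dt f t x + _root_.dt g t x :=
  ((hf.add hg).hasDerivAt ht x).unique ((hf.hasDerivAt ht x).add (hg.hasDerivAt ht x))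

theorem dt_sub (hf : SmoothEvolution f) (hg : SmoothEvolution g) {t : ℝ} (ht : 0 < t)
    (x : Plane) : _root_.dt (f - g) t x = _root_.dt f t x - _root_.dt g t x :=
  ((hf.sub hg).hasDerivAt ht x).unique ((hf.hasDerivAt ht x).sub (hg.hasDerivAt ht x))

theorem dt_mul (hf : SmoothEvolution f) (hg : SmoothEvolution g) {t : ℝ} (ht : 0 < t)
    (x : Plane) :
    _root_.dt (f * g) t x = _root_.dt f t x * g t x + f t x * _root_.dt g t x :=
  ((hf.mul hg).hasDerivAt ht x).unique ((hf.hasDerivAt ht x).mul (hg.hasDerivAt ht x))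

theorem dt_smul (c : ℝ) (hf : SmoothEvolution f) {t : ℝ} (ht : 0 < t) (x : Plane) :
    _root_.dt (c • f) t x = c * _root_.dt f t x :=
  ((hf.smul c).hasDerivAt ht x).unique ((hf.hasDerivAt ht x).const_smul c)

theorem dx_add (hf : SmoothEvolution f) (hg : SmoothEvolution g) (j : Fin 2) {t : ℝ}
    (ht : 0 < t) (x : Plane) :
    _root_.dx j (f + g) t x = _root_.dx j f t x + _root_.dx j g t x := by
  simp [_root_.dx, fderiv_add (hf.differentiable_slice ht.le x) (hg.differentiable_slice ht.le x)]

theorem dx_mul (hf : SmoothEvolution f) (hg : SmoothEvolution g) (j : Fin 2) {t : ℝ}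
    (ht : 0 < t) (x : Plane) :
    _root_.dx j (f * g) t x = _root_.dx j f t x * g t x + f t x * _root_.dx j g t x := by
  simp [_root_.dx, fderiv_mul (hf.differentiable_slice ht.le x) (hg.differentiable_slice ht.le x)]
  ring

theorem dx_smul (c : ℝ) (hf : SmoothEvolution f) (j : Fin 2) {t : ℝ} (ht : 0 < t) (x : Plane) :
    _root_.dx j (c • f) t x = c * _root_.dx j f t x := by
  simp [_root_.dx, fderiv_const_smul (hf.differentiable_slice ht.le x)]

end SmoothEvolution

theorem dt_of_space (φ : Plane → ℝ) (t : ℝ) (x : Plane) : dt (fun _ => φ) t x = 0 := by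
  simp [dt]

theorem dx_of_time (φ : ℝ → ℝ) (j : Fin 2) (t : ℝ) (x : Plane) :
    dx j (fun t _ => φ t) t x = 0 := by
  simp [dx]

theorem dt_of_time {φ : ℝ → ℝ} {φ' t : ℝ} (ht : 0 ≤ t) (h : HasDerivAt φ φ' t) (x : Plane) :
    dt (fun t _ => φ t) t x = φ' :=
  h.hasDerivWithinAt.derivWithin (uniqueDiffOn_Ici 0 t ht)

/-! ### Smoothness of time primitives up to t = 0 -/

theorem hasFDerivAt_intervalIntegral_of_continuous {F : ℝ → Plane → ℝ}
    {F' : ℝ → Plane → Plane →L[ℝ] ℝ} (hF : Continuous (Function.uncurry F))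
    (hF' : Continuous (Function.uncurry F')) (hd : ∀ s x, HasFDerivAt (F s) (F' s x) x)
    (t : ℝ) (x : Plane) :
    HasFDerivAt (fun y => ∫ s in (0 : ℝ)..t, F s y) (∫ s in (0 : ℝ)..t, F' s x) x := by
  obtain ⟨C, hC⟩ := ((isCompact_uIcc (a := (0 : ℝ)) (b := t)).prod
    (isCompact_closedBall x 1)).exists_bound_of_continuousOn hF'.continuousOn
  have hFs : ∀ y, Continuous fun s => F s y := fun y =>
    hF.comp (Continuous.prodMk continuous_id continuous_const)
  have hFs' : ∀ y, Continuous fun s => F' s y := fun y =>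
    hF'.comp (Continuous.prodMk continuous_id continuous_const)
  refine intervalIntegral.hasFDerivAt_integral_of_dominated_of_fderiv_le
    (F := fun y s => F s y) (F' := fun y s => F' s y) (bound := fun _ => C)
    (Metric.ball_mem_nhds x one_pos) ?_ ((hFs x).intervalIntegrable _ _) ?_ ?_
    intervalIntegrable_const ?_
  · exact Eventually.of_forall fun y => (hFs y).aestronglyMeasurable
  · exact (hFs' x).aestronglyMeasurable
  · exact Eventually.of_forall fun s hs y hy =>
      hC (s, y) ⟨uIoc_subset_uIcc hs, Metric.ball_subset_closedBall hy⟩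
  · exact Eventually.of_forall fun s _ y _ => hd s y

theorem continuous_uncurry_primitive {E : Type*} [NormedAddCommGroup E] [NormedSpace ℝ E]
    {F : ℝ → Plane → E} (hF : Continuous (Function.uncurry F)) :
    Continuous (fun p : ℝ × Plane => ∫ s in (0 : ℝ)..p.1, F s p.2) := by
  refine intervalIntegral.continuous_parametric_intervalIntegral_of_continuous
    (f := fun (p : ℝ × Plane) s => F s p.2) (s := Prod.fst) ?_ continuous_fst
  exact hF.comp (f := fun q : (ℝ × Plane) × ℝ => (q.2, q.1.2)) (by fun_prop)

theorem hasFDerivAt_primitive {F : ℝ → Plane → ℝ}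
    {F' : ℝ → Plane → Plane →L[ℝ] ℝ} (hF : Continuous (Function.uncurry F))
    (hF' : Continuous (Function.uncurry F')) (hd : ∀ s x, HasFDerivAt (F s) (F' s x) x)
    (p : ℝ × Plane) :
    HasFDerivAt (fun p : ℝ × Plane => ∫ s in (0 : ℝ)..p.1, F s p.2)
      ((ContinuousLinearMap.toSpanSingleton ℝ (F p.1 p.2)).coprod
        (∫ s in (0 : ℝ)..p.1, F' s p.2)) p := by
  refine (hasStrictFDerivAt_uncurry_coprod (u := p)
    (f := fun t x => ∫ s in (0 : ℝ)..t, F s x)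
    (f₁ := fun t x => ContinuousLinearMap.toSpanSingleton ℝ (F t x))
    (f₂ := fun t x => ∫ s in (0 : ℝ)..t, F' s x) ?_ ?_ ?_ ?_).hasFDerivAt
  · refine Eventually.of_forall fun v => ?_
    have hc : Continuous fun s => F s v.2 :=
      hF.comp (Continuous.prodMk continuous_id continuous_const)
    exact (intervalIntegral.integral_hasDerivAt_right (hc.intervalIntegrable _ _)
      (hc.stronglyMeasurableAtFilter _ _) hc.continuousAt).hasFDerivAt
  · exact Eventually.of_forall fun v => hasFDerivAt_intervalIntegral_of_continuous hF hF' hd _ _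
  · have : Continuous fun c : ℝ => ContinuousLinearMap.toSpanSingleton ℝ c :=
      (ContinuousLinearMap.toSpanSingletonCLE (𝕜 := ℝ) (E := ℝ)).continuous
    exact (this.comp hF).continuousAt
  · exact (continuous_uncurry_primitive hF').continuousAt

/-- The primitive in time, vanishing at `t = 0`. -/
def primitive (f : ℝ → Plane → ℝ) (t : ℝ) (x : Plane) : ℝ :=
  ∫ s in (0 : ℝ)..t, f s x

theorem plane_eq_sum (x : Plane) : x = x 0 • coordVec 0 + x 1 • coordVec 1 := by
  ext i; fin_cases i <;> simp [coordVec]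

theorem continuous_max_zero : Continuous fun p : ℝ × Plane => (max p.1 0, p.2) := by fun_prop

/-- Freezing the integrand at its value at s = 0 for negative times makes it continuous on the whole
line. Two-sided differentiation under the integral then applies, even at the boundary t = 0. -/
theorem primitive_eq_max {f : ℝ → Plane → ℝ} {t : ℝ} (ht : 0 ≤ t) (x : Plane) :
    primitive f t x = ∫ s in (0 : ℝ)..t, f (max s 0) x := by
  refine intervalIntegral.integral_congr fun s hs => ?_
  rw [uIcc_of_le ht] at hs
  simp [max_eq_left hs.1]

namespace SmoothEvolution

variable {f : ℝ → Plane → ℝ}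

theorem continuous_max (hf : SmoothEvolution f) :
    Continuous (Function.uncurry fun s x => f (max s 0) x) :=
  ContinuousOn.comp_continuous (f := fun p : ℝ × Plane => (max p.1 0, p.2))
    (ContDiffOn.continuousOn hf) continuous_max_zero
    fun _ => mem_halfSpace (le_max_right _ _) _

theorem continuous_fderiv_max (hf : SmoothEvolution f) :
    Continuous (Function.uncurry fun s x => fderiv ℝ (f (max s 0)) x) := by
  have h : (Function.uncurry fun s x => fderiv ℝ (f (max s 0)) x) = fun p : ℝ × Plane =>
      (fderivWithin ℝ (fun p : ℝ × Plane => f p.1 p.2) halfSpace (max p.1 0, p.2)).comp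
        (ContinuousLinearMap.inr ℝ ℝ Plane) := by
    funext p
    ext v
    simpa [Function.uncurry] using hf.fderiv_slice (le_max_right p.1 0) p.2 v
  rw [h]
  have h2 := ContinuousOn.comp_continuous (f := fun p : ℝ × Plane => (max p.1 0, p.2))
    (ContDiffOn.fderivWithin hf uniqueDiffOn_halfSpace (m := ∞) (by simp)).continuousOn
    continuous_max_zero fun p => mem_halfSpace (le_max_right _ _) _
  exact h2.clm_comp continuous_const

/-- The spatial coefficients are themselves primitives of smooth evolutions. This form of the
derivative lets smoothness be proved by induction on the order. -/
theorem primitive_hasFDerivWithinAt (hf : SmoothEvolution f) {p : ℝ × Plane}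
    (hp : p ∈ halfSpace) :
    HasFDerivWithinAt (fun p : ℝ × Plane => primitive f p.1 p.2)
      (f p.1 p.2 • ContinuousLinearMap.fst ℝ ℝ Plane +
        (primitive (_root_.dx 0 f) p.1 p.2 •
          (EuclideanSpace.proj (𝕜 := ℝ) (0 : Fin 2)).comp (ContinuousLinearMap.snd ℝ ℝ Plane) +
        primitive (_root_.dx 1 f) p.1 p.2 •
          (EuclideanSpace.proj (𝕜 := ℝ) (1 : Fin 2)).comp (ContinuousLinearMap.snd ℝ ℝ Plane)))
      halfSpace p := by
  have hcont := hf.continuous_fderiv_max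
  have h := (hasFDerivAt_primitive hf.continuous_max hcont
    (fun s x => (hf.differentiable_slice (le_max_right s 0) x).hasFDerivAt) p).hasFDerivWithinAt
      (s := halfSpace)
  have h' := h.congr (fun q hq => primitive_eq_max (f := f) hq.1 q.2) (primitive_eq_max hp.1 p.2)
  refine h'.congr_fderiv ?_
  have hint : IntervalIntegrable (fun s => fderiv ℝ (f (max s 0)) p.2) volume 0 p.1 :=
    (hcont.comp (Continuous.prodMk continuous_id continuous_const)).intervalIntegrable _ _
  have hj : ∀ j, (∫ s in (0 : ℝ)..p.1, fderiv ℝ (f (max s 0)) p.2) (coordVec j) =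
      primitive (_root_.dx j f) p.1 p.2 := by
    intro j
    rw [ContinuousLinearMap.intervalIntegral_apply hint, primitive_eq_max hp.1]
    rfl
  refine ContinuousLinearMap.ext fun v => ?_
  have hv : (∫ s in (0 : ℝ)..p.1, fderiv ℝ (f (max s 0)) p.2) v.2 =
      primitive (_root_.dx 0 f) p.1 p.2 * v.2 0 + primitive (_root_.dx 1 f) p.1 p.2 * v.2 1 := by
    conv_lhs => rw [plane_eq_sum v.2]
    rw [map_add, map_smul, map_smul, hj, hj]
    simp only [smul_eq_mul]; ring
  simp only [ContinuousLinearMap.coprod_apply, hv, max_eq_left (show 0 ≤ p.1 from hp.1)]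
  simp [mul_comm]

protected theorem primitive (hf : SmoothEvolution f) : SmoothEvolution (primitive f) := by
  -- The induction is over all `f` at once, because the step applies the hypothesis to `dx 0 f` and
  -- `dx 1 f`.
  have key : ∀ (n : ℕ) (f : ℝ → Plane → ℝ), SmoothEvolution f →
      ContDiffOn ℝ n (fun p : ℝ × Plane => _root_.primitive f p.1 p.2) halfSpace := by
    intro n
    induction n with
    | zero =>
      intro f hf
      rw [Nat.cast_zero, contDiffOn_zero]
      exact fun p hp => (hf.primitive_hasFDerivWithinAt hp).continuousWithinAt
    | succ n ih =>
      intro f hf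
      rw [Nat.cast_succ, contDiffOn_succ_iff_fderivWithin uniqueDiffOn_halfSpace]
      refine ⟨fun p hp => (hf.primitive_hasFDerivWithinAt hp).differentiableWithinAt,
        fun h => absurd h (by simp), ?_⟩
      refine ContDiffOn.congr ?_ fun p hp =>
        (hf.primitive_hasFDerivWithinAt hp).fderivWithin (uniqueDiffOn_halfSpace p hp)
      exact ((ContDiffOn.of_le hf (by exact_mod_cast le_top)).smul contDiffOn_const).add
        (((ih _ (hf.dx 0)).smul contDiffOn_const).add ((ih _ (hf.dx 1)).smul contDiffOn_const))
  exact contDiffOn_infty.2 fun n => key n f hf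

theorem dt_primitive (hf : SmoothEvolution f) {t : ℝ} (ht : 0 ≤ t) (x : Plane) :
    _root_.dt (_root_.primitive f) t x = f t x := by
  rw [hf.primitive.dt_eq ht, (hf.primitive_hasFDerivWithinAt (mem_halfSpace ht x)).fderivWithin
    (uniqueDiffOn_halfSpace _ (mem_halfSpace ht x))]
  simp

/-- A smooth evolution whose time derivative vanishes for `t > 0` is constant in time. -/
theorem eq_initial_of_dt_eq_zero (hf : SmoothEvolution f) {x : Plane} {T : ℝ} (hT : 0 ≤ T)
    (h : ∀ t ∈ Ioo 0 T, _root_.dt f t x = 0) : f T x = f 0 x := by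
  have hcont : ContinuousOn (fun s => f s x) (Icc 0 T) := fun s hs =>
    ((hf.hasDerivWithinAt hs.1 x).continuousWithinAt).mono Icc_subset_Ici_self
  rcases hT.eq_or_lt with rfl | hT'
  · rfl
  obtain ⟨c, hc, hc'⟩ := exists_hasDerivAt_eq_slope (fun s => f s x) _ hT' hcont
    (fun s hs => hf.hasDerivAt hs.1 x)
  rw [h c hc, eq_comm, div_eq_zero_iff] at hc'
  rcases hc' with h | h <;> linarith

end SmoothEvolution

/-! ### Integrals of compactly supported densities -/

theorem integrable_of_vanish {f : Plane → ℝ} (hf : Continuous f) {K : Set Plane}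
    (hK : IsCompact K) (h : ∀ x ∉ K, f x = 0) : Integrable f :=
  hf.integrable_of_hasCompactSupport (HasCompactSupport.intro hK h)

theorem fderiv_eq_zero_of_vanish {f : Plane → ℝ} {K : Set Plane} (hK : IsClosed K)
    (h : ∀ x ∉ K, f x = 0) {x : Plane} (hx : x ∉ K) : fderiv ℝ f x = 0 := by
  have : f =ᶠ[nhds x] fun _ => 0 := by
    filter_upwards [hK.isOpen_compl.mem_nhds hx] with y hy using h y hy
  rw [this.fderiv_eq]; simp

theorem integral_fderiv_eq_zero {h : Plane → ℝ} (hh : ContDiff ℝ 1 h) {K : Set Plane}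
    (hK : IsCompact K) (h0 : ∀ x ∉ K, h x = 0) (v : Plane) : ∫ x, fderiv ℝ h x v = 0 := by
  have hi : Integrable h := integrable_of_vanish hh.continuous hK h0
  have hi' : Integrable fun x => fderiv ℝ h x v :=
    integrable_of_vanish ((hh.continuous_fderiv one_ne_zero).clm_apply continuous_const) hK
      fun x hx => by simp [fderiv_eq_zero_of_vanish hK.isClosed h0 hx]
  -- Integration by parts against the constant function 1.
  have := integral_mul_fderiv_eq_neg_fderiv_mul_of_integrable (μ := volume) (𝕜 := ℝ)
    (f := fun _ : Plane => (1 : ℝ)) (g := h) (v := v) (by simp) (by simpa using hi')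
    (by simpa using hi) (fun x _ => by fun_prop)
    (fun x _ => hh.differentiable one_ne_zero x)
  simpa using this

theorem dt_eq_zero_of_vanish {f : ℝ → Plane → ℝ} {T t : ℝ} {x : Plane}
    (h : ∀ s ∈ Icc 0 T, f s x = 0) (ht : t ∈ Ioo 0 T) : dt f t x = 0 := by
  have : (fun s => f s x) =ᶠ[nhdsWithin t (Ici 0)] fun _ => 0 := by
    filter_upwards [nhdsWithin_le_nhds (Icc_mem_nhds ht.1 ht.2)] with s hs using h s hs
  rw [dt, this.derivWithin_eq (h t ⟨ht.1.le, ht.2.le⟩)]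
  simp

/-- A local conservation inequality `∂_t e ≤ div h` with compactly supported terms makes the
integral of `e` nonincreasing. -/
theorem integral_le_integral_initial {e h₀ h₁ : ℝ → Plane → ℝ} (he : SmoothEvolution e)
    (hh₀ : SmoothEvolution h₀) (hh₁ : SmoothEvolution h₁) {T : ℝ} (hT : 0 ≤ T) {K : Set Plane}
    (hK : IsCompact K) (heK : ∀ t ∈ Icc 0 T, ∀ x ∉ K, e t x = 0)
    (hK₀ : ∀ t ∈ Icc 0 T, ∀ x ∉ K, h₀ t x = 0) (hK₁ : ∀ t ∈ Icc 0 T, ∀ x ∉ K, h₁ t x = 0)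
    (hle : ∀ t ∈ Ioo 0 T, ∀ x, dt e t x ≤ dx 0 h₀ t x + dx 1 h₁ t x) :
    ∫ x, e T x ≤ ∫ x, e 0 x := by
  have hsub : Icc 0 T ×ˢ (univ : Set Plane) ⊆ halfSpace :=
    prod_mono Icc_subset_Ici_self Subset.rfl
  have hcont : ContinuousOn (fun t => ∫ x, e t x) (Icc 0 T) :=
    continuousOn_integral_of_compact_support hK
      ((ContDiffOn.continuousOn he).mono hsub) fun t x ht hx => heK t ht x hx
  have hdtK : ∀ t ∈ Ioo 0 T, ∀ x ∉ K, dt e t x = 0 := fun t ht x hx =>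
    dt_eq_zero_of_vanish (fun s hs => heK s hs x hx) ht
  have hderiv : ∀ t ∈ Ioo 0 T, HasDerivAt (fun t => ∫ x, e t x) (∫ x, dt e t x) t := by
    intro t ht
    obtain ⟨C, hC⟩ := ((isCompact_Icc (a := (0 : ℝ)) (b := T)).prod hK).exists_bound_of_continuousOn
      ((ContDiffOn.continuousOn he.dt).mono ((prod_mono Subset.rfl (subset_univ K)).trans hsub))
    refine (hasDerivAt_integral_of_dominated_loc_of_deriv_le
      (bound := K.indicator fun _ => C) (Ioo_mem_nhds ht.1 ht.2) ?_ ?_ ?_ ?_ ?_ ?_).2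
    · filter_upwards [Ioo_mem_nhds ht.1 ht.2] with s hs
      exact (he.continuous_slice hs.1.le).aestronglyMeasurable
    · exact integrable_of_vanish (he.continuous_slice ht.1.le) hK (heK t ⟨ht.1.le, ht.2.le⟩)
    · exact (he.dt.continuous_slice ht.1.le).aestronglyMeasurable
    · refine Eventually.of_forall fun x s hs => ?_
      by_cases hx : x ∈ K
      · simpa [hx] using hC (s, x) ⟨⟨hs.1.le, hs.2.le⟩, hx⟩
      · simp [hx, hdtK s hs x hx]
    · exact (integrable_indicator_iff hK.measurableSet).2
        (integrableOn_const hK.measure_lt_top.ne)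
    · exact Eventually.of_forall fun x s hs => he.hasDerivAt hs.1 x
  have hanti : AntitoneOn (fun t => ∫ x, e t x) (Icc 0 T) := by
    refine antitoneOn_of_deriv_nonpos (convex_Icc 0 T) hcont ?_ ?_ <;>
      rw [interior_Icc] <;> intro t ht
    · exact (hderiv t ht).differentiableAt.differentiableWithinAt
    · rw [(hderiv t ht).deriv]
      have ht' : t ∈ Icc 0 T := ⟨ht.1.le, ht.2.le⟩
      have hi : ∀ {h : ℝ → Plane → ℝ} (j : Fin 2), SmoothEvolution h →
          (∀ t ∈ Icc 0 T, ∀ x ∉ K, h t x = 0) → Integrable (dx j h t) ∧ ∫ x, dx j h t x = 0 := by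
        intro h j hh h0
        refine ⟨integrable_of_vanish ((hh.dx j).continuous_slice ht.1.le) hK fun x hx => ?_,
          integral_fderiv_eq_zero ((hh.contDiff_slice ht.1.le).of_le
            (by exact_mod_cast le_top)) hK (h0 t ht') _⟩
        simp [dx, fderiv_eq_zero_of_vanish hK.isClosed (h0 t ht') hx]
      have h0 := hi 0 hh₀ hK₀
      have h1 := hi 1 hh₁ hK₁
      calc ∫ x, dt e t x ≤ ∫ x, (dx 0 h₀ t x + dx 1 h₁ t x) :=
            integral_mono (integrable_of_vanish (he.dt.continuous_slice ht.1.le) hK (hdtK t ht))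
              (h0.1.add h1.1) (hle t ht)
        _ = 0 := by rw [integral_add h0.1 h1.1, h0.2, h1.2, add_zero]
  exact hanti ⟨le_rfl, hT⟩ ⟨hT, le_rfl⟩ hT

/-! ### A Hardy inequality in the plane with logarithmic constant -/

theorem norm_sq_plane (x : Plane) : ‖x‖ ^ 2 = x 0 ^ 2 + x 1 ^ 2 := by
  rw [EuclideanSpace.real_norm_sq_eq, Fin.sum_univ_two]

/-- `1 + |x|²`. -/
def weight (x : Plane) : ℝ := 1 + x 0 ^ 2 + x 1 ^ 2

theorem weight_eq (x : Plane) : weight x = 1 + ‖x‖ ^ 2 := by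
  rw [norm_sq_plane, weight]; ring

theorem one_le_weight (x : Plane) : 1 ≤ weight x := by
  rw [weight_eq]; nlinarith [sq_nonneg ‖x‖]

theorem weight_pos (x : Plane) : 0 < weight x := one_pos.trans_le (one_le_weight x)

theorem contDiff_coord (j : Fin 2) : ContDiff ℝ ∞ fun x : Plane => x j :=
  (EuclideanSpace.proj (𝕜 := ℝ) j).contDiff

theorem contDiff_weight : ContDiff ℝ ∞ weight :=
  (contDiff_const.add ((contDiff_coord 0).pow 2)).add ((contDiff_coord 1).pow 2)

theorem hasFDerivAt_coord (j : Fin 2) (x : Plane) :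
    HasFDerivAt (fun x : Plane => x j) (EuclideanSpace.proj (𝕜 := ℝ) j) x :=
  (EuclideanSpace.proj (𝕜 := ℝ) j).hasFDerivAt

theorem hasFDerivAt_weight (x : Plane) :
    HasFDerivAt weight ((2 * x 0) • EuclideanSpace.proj (𝕜 := ℝ) (0 : Fin 2) +
      (2 * x 1) • EuclideanSpace.proj (𝕜 := ℝ) (1 : Fin 2)) x := by
  have h := (((hasFDerivAt_coord 0 x).pow 2).const_add 1).add ((hasFDerivAt_coord 1 x).pow 2)
  refine h.congr_fderiv ?_
  ext; simp

/-- Hardy inequality in the plane with a logarithmic constant. -/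
theorem integral_sq_div_weight_le {f : Plane → ℝ} (hf : ContDiff ℝ 1 f) {R : ℝ} (hR : 0 ≤ R)
    (h0 : ∀ x, R < ‖x‖ → f x = 0) :
    ∫ x, f x ^ 2 / weight x ^ 2 ≤ (1 + Real.log (1 + (R + 1) ^ 2)) / 4 *
      ∫ x, (fderiv ℝ f x (coordVec 0) ^ 2 + fderiv ℝ f x (coordVec 1) ^ 2) := by
  set A := 1 + Real.log (1 + (R + 1) ^ 2) with hA
  have hApos : 0 < A := by
    have := Real.log_nonneg (show 1 ≤ 1 + (R + 1) ^ 2 by nlinarith)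
    linarith
  -- Since Δ log(1 + |x|²) = 4/(1 + |x|²)², this φ is superharmonic with -Δφ = 4/`weight`². The
  -- constant `A` ensures 1 ≤ φ ≤ A on the ball where `f` lives.
  let φ : Plane → ℝ := fun x => A - Real.log (weight x)
  have hφ1 : ∀ x, ‖x‖ ≤ R + 1 → 1 ≤ φ x := by
    intro x hx
    have h1 : weight x ≤ 1 + (R + 1) ^ 2 := by
      rw [weight_eq]; nlinarith [norm_nonneg x]
    have := Real.log_le_log (weight_pos x) h1
    simp only [φ, hA]; linarith
  have hφA : ∀ x, φ x ≤ A := fun x => by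
    have := Real.log_nonneg (one_le_weight x)
    simp only [φ]; linarith
  have hφd : ∀ x, HasFDerivAt φ (-((weight x)⁻¹ •
      ((2 * x 0) • EuclideanSpace.proj (𝕜 := ℝ) (0 : Fin 2) +
      (2 * x 1) • EuclideanSpace.proj (𝕜 := ℝ) (1 : Fin 2)))) x := fun x =>
    ((hasFDerivAt_weight x).log (weight_pos x).ne').const_sub A
  have hφc : ∀ x, ContDiffAt ℝ 1 φ x := fun x => contDiffAt_const.sub
    ((contDiff_weight.contDiffAt.of_le (by exact_mod_cast le_top)).log (weight_pos x).ne')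
  -- The vector field f² ∇φ/φ, whose divergence has integral zero.
  let h : Fin 2 → Plane → ℝ := fun j x => f x ^ 2 * (-2 * x j / (weight x * φ x))
  have hK : IsCompact (Metric.closedBall (0 : Plane) R) := isCompact_closedBall _ _
  have hKf : ∀ x ∉ Metric.closedBall (0 : Plane) R, f x = 0 := fun x hx =>
    h0 x (by simpa using hx)
  have hhK : ∀ j, ∀ x ∉ Metric.closedBall (0 : Plane) R, h j x = 0 := fun j x hx => by
    simp [h, hKf x hx]
  have hhc : ∀ j, ContDiff ℝ 1 (h j) := by
    intro j
    rw [contDiff_iff_contDiffAt]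
    intro x
    rcases le_or_gt ‖x‖ R with hx | hx
    · have hφx := hφ1 x (by linarith)
      refine (hf.contDiffAt.pow 2).mul (ContDiffAt.div ?_ ?_ ?_)
      · exact contDiffAt_const.mul ((contDiff_coord j).contDiffAt.of_le (by exact_mod_cast le_top))
      · exact (contDiff_weight.contDiffAt.of_le (by exact_mod_cast le_top)).mul (hφc x)
      · exact mul_ne_zero (weight_pos x).ne' (by linarith)
    -- The denominator may vanish out here, but `f` is identically zero near such a point.
    · have : h j =ᶠ[nhds x] fun _ => 0 := by
        filter_upwards [hK.isClosed.isOpen_compl.mem_nhds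
          (show x ∈ (Metric.closedBall (0 : Plane) R)ᶜ by simpa using hx)] with y hy
          using hhK j y hy
      exact contDiffAt_const.congr_of_eventuallyEq this
  have hfK : ∀ v, ∀ x ∉ Metric.closedBall (0 : Plane) R, fderiv ℝ f x v = 0 := fun v x hx => by
    simp [fderiv_eq_zero_of_vanish hK.isClosed hKf hx]
  have hfc : ∀ v, Continuous fun x => fderiv ℝ f x v := fun v =>
    (hf.continuous_fderiv one_ne_zero).clm_apply continuous_const
  have hhi : ∀ j, Integrable fun x => fderiv ℝ (h j) x (coordVec j) := fun j =>
    integrable_of_vanish (((hhc j).continuous_fderiv one_ne_zero).clm_apply continuous_const) hK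
      fun x hx => by simp [fderiv_eq_zero_of_vanish hK.isClosed (hhK j) hx]
  have hgi : Integrable fun x =>
      fderiv ℝ f x (coordVec 0) ^ 2 + fderiv ℝ f x (coordVec 1) ^ 2 :=
    integrable_of_vanish (((hfc _).pow 2).add ((hfc _).pow 2)) hK
      fun x hx => by simp [hfK _ x hx]
  have hqi : Integrable fun x => f x ^ 2 / weight x ^ 2 :=
    integrable_of_vanish ((hf.continuous.pow 2).div (contDiff_weight.continuous.pow 2)
      fun x => (pow_pos (weight_pos x) 2).ne') hK fun x hx => by simp [hKf x hx]
  have hpt : ∀ x, fderiv ℝ (h 0) x (coordVec 0) + fderiv ℝ (h 1) x (coordVec 1) +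
      4 / A * (f x ^ 2 / weight x ^ 2) ≤
        fderiv ℝ f x (coordVec 0) ^ 2 + fderiv ℝ f x (coordVec 1) ^ 2 := by
    intro x
    by_cases hx : x ∈ Metric.closedBall (0 : Plane) R
    · have hφx : 1 ≤ φ x := hφ1 x (by have : ‖x‖ ≤ R := by simpa using hx
                                      linarith)
      have hq := weight_pos x
      have hne : weight x * φ x ≠ 0 := mul_ne_zero hq.ne' (by linarith)
      have hd : ∀ j, fderiv ℝ (h j) x (coordVec j) =
          2 * f x * fderiv ℝ f x (coordVec j) * (-2 * x j / (weight x * φ x)) +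
          f x ^ 2 * (-2 / (weight x * φ x) +
            2 * x j * (2 * x j * φ x - 2 * x j) / (weight x * φ x) ^ 2) := by
        intro j
        have h1 := (((hf.differentiable one_ne_zero x).hasFDerivAt).pow 2).mul
          (((hasFDerivAt_coord j x).const_mul (-2)).mul
            ((hasDerivAt_inv hne).comp_hasFDerivAt x ((hasFDerivAt_weight x).mul (hφd x))))
        have h2 : h j = (fun x => f x ^ 2) *
            ((fun y : Plane => -2 * y j) * (fun y => y⁻¹) ∘ (weight * φ)) := by
          funext y; simp [h, div_eq_mul_inv]
        rw [h2, HasFDerivAt.fderiv h1]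
        fin_cases j <;> simp [coordVec] <;> field_simp <;> ring
      rw [hd, hd]
      have hw : weight x = 1 + x 0 ^ 2 + x 1 ^ 2 := rfl
      have hle : 4 / A * (f x ^ 2 / weight x ^ 2) ≤ 4 / φ x * (f x ^ 2 / weight x ^ 2) := by
        gcongr
        exact hφA x
      refine (add_le_add_right hle _).trans ?_
      set F0 := fderiv ℝ f x (coordVec 0)
      set F1 := fderiv ℝ f x (coordVec 1)
      have hφ0 : φ x ≠ 0 := by linarith
      -- Ground state identity: |∇f|² - div(f² ∇φ/φ) + f² Δφ/φ = |∇f - f ∇φ/φ|².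
      have e1 : F0 ^ 2 + F1 ^ 2 -
          (2 * f x * F0 * (-2 * x 0 / (weight x * φ x)) +
          f x ^ 2 * (-2 / (weight x * φ x) +
            2 * x 0 * (2 * x 0 * φ x - 2 * x 0) / (weight x * φ x) ^ 2) +
          (2 * f x * F1 * (-2 * x 1 / (weight x * φ x)) +
          f x ^ 2 * (-2 / (weight x * φ x) +
            2 * x 1 * (2 * x 1 * φ x - 2 * x 1) / (weight x * φ x) ^ 2)) +
          4 / φ x * (f x ^ 2 / weight x ^ 2)) =
          (F0 + f x * (2 * x 0 / (weight x * φ x))) ^ 2 +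
          (F1 + f x * (2 * x 1 / (weight x * φ x))) ^ 2 := by
        have hx1 : x 1 ^ 2 = weight x - 1 - x 0 ^ 2 := by rw [hw]; ring
        have hq0 := hq.ne'
        field_simp
        ring_nf
        rw [hx1]
        ring
      have := add_nonneg (sq_nonneg (F0 + f x * (2 * x 0 / (weight x * φ x))))
        (sq_nonneg (F1 + f x * (2 * x 1 / (weight x * φ x))))
      linarith
    · simp only [fderiv_eq_zero_of_vanish hK.isClosed (hhK _) hx, hKf x hx, hfK _ x hx]
      simp
  have hint := integral_mono (((hhi 0).add (hhi 1)).add (hqi.const_mul (4 / A))) hgi hpt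
  have hsplit : ∫ x, (fderiv ℝ (h 0) x (coordVec 0) + fderiv ℝ (h 1) x (coordVec 1) +
      4 / A * (f x ^ 2 / weight x ^ 2)) = 4 / A * ∫ x, f x ^ 2 / weight x ^ 2 := by
    have h01 : Integrable fun x =>
        fderiv ℝ (h 0) x (coordVec 0) + fderiv ℝ (h 1) x (coordVec 1) := (hhi 0).add (hhi 1)
    rw [integral_add h01 (hqi.const_mul (4 / A)), integral_add (hhi 0) (hhi 1),
      integral_fderiv_eq_zero (hhc 0) hK (hhK 0), integral_fderiv_eq_zero (hhc 1) hK (hhK 1),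
      integral_const_mul]
    ring
  have hfin := hsplit.symm.le.trans hint
  calc ∫ x, f x ^ 2 / weight x ^ 2 = A / 4 * (4 / A * ∫ x, f x ^ 2 / weight x ^ 2) := by
        field_simp
    _ ≤ _ := by gcongr

/-! ### Reduction to scalar components -/

/-- Scalar components `w₀, w₁` of a smooth solution of the damped elastic wave equation with
Lamé constants encoded by `a` and `c = b² - a²`. -/
structure ElasticSystem (a c : ℝ) (V : Plane → ℝ) (w₀ w₁ : ℝ → Plane → ℝ) : Prop where
  smooth₀ : SmoothEvolution w₀
  smooth₁ : SmoothEvolution w₁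
  eqn₀ : ∀ t, 0 < t → ∀ x, dt (dt w₀) t x =
    a ^ 2 * (dx 0 (dx 0 w₀) t x + dx 1 (dx 1 w₀) t x) +
      c * (dx 0 (dx 0 w₀) t x + dx 0 (dx 1 w₁) t x) - V x * dt w₀ t x
  eqn₁ : ∀ t, 0 < t → ∀ x, dt (dt w₁) t x =
    a ^ 2 * (dx 0 (dx 0 w₁) t x + dx 1 (dx 1 w₁) t x) +
      c * (dx 1 (dx 0 w₀) t x + dx 1 (dx 1 w₁) t x) - V x * dt w₁ t x

/-- The `i`-th component of a time-dependent vector field. -/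
def component (u : ℝ → Plane → Plane) (i : Fin 2) (t : ℝ) (x : Plane) : ℝ := u t x i

theorem derivWithin_component {g : ℝ → Plane} {g' : Fin 2 → ℝ} {s : Set ℝ} {t : ℝ}
    (hs : UniqueDiffWithinAt ℝ s t) (h : ∀ i, HasDerivWithinAt (fun r => g r i) (g' i) s t)
    (i : Fin 2) : derivWithin g s t i = g' i := by
  have hd : DifferentiableWithinAt ℝ g s t :=
    (differentiableWithinAt_euclidean (𝕜 := ℝ)).2 fun i => (h i).differentiableWithinAt
  have := (EuclideanSpace.proj (𝕜 := ℝ) i).hasFDerivAt.comp_hasDerivWithinAt t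
    hd.hasDerivWithinAt
  exact hs.eq_deriv _ this (h i)

theorem laplacian_eq_dx {f : ℝ → Plane → ℝ} (hf : SmoothEvolution f) {t : ℝ} (ht : 0 ≤ t)
    (x : Plane) : Laplacian.laplacian (f t) x = dx 0 (dx 0 f) t x + dx 1 (dx 1 f) t x := by
  have hd : DifferentiableAt ℝ (fderiv ℝ (f t)) x :=
    (((hf.contDiff_slice ht).fderiv_right (m := 1) (by norm_cast)).differentiable one_ne_zero) x
  have h : ∀ j, fderiv ℝ (fderiv ℝ (f t)) x (coordVec j) (coordVec j) =
      dx j (dx j f) t x := by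
    intro j
    change _ = fderiv ℝ (fun y => fderiv ℝ (f t) y (coordVec j)) x (coordVec j)
    rw [fderiv_clm_apply hd (differentiableAt_const _)]
    simp
  rw [InnerProductSpace.laplacian_eq_iteratedFDeriv_orthonormalBasis (f t)
    (EuclideanSpace.basisFun (Fin 2) ℝ)]
  simp only [Fin.sum_univ_two, iteratedFDeriv_two_apply, EuclideanSpace.basisFun_apply]
  rw [← h 0, ← h 1]
  rfl

theorem gradient_apply (f : Plane → ℝ) (x : Plane) (i : Fin 2) :
    gradient f x i = fderiv ℝ f x (coordVec i) := by
  have h : inner ℝ (gradient f x) (coordVec i) = fderiv ℝ f x (coordVec i) :=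
    InnerProductSpace.toDual_symm_apply
  rw [← h, coordVec, EuclideanSpace.inner_single_right]
  simp

namespace IsSmoothSolution

variable {a b : ℝ} {V : Plane → ℝ} {u₀ u₁ : Plane → Plane} {u : ℝ → Plane → Plane}

theorem smoothEvolution_component (hu : IsSmoothSolution a b V u₀ u₁ u) (i : Fin 2) :
    SmoothEvolution (component u i) :=
  ((EuclideanSpace.proj (𝕜 := ℝ) i).contDiff).comp_contDiffOn hu.smooth

theorem timeDeriv_apply (hu : IsSmoothSolution a b V u₀ u₁ u) {t : ℝ} (ht : 0 ≤ t) (x : Plane)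
    (i : Fin 2) : timeDeriv u t x i = dt (component u i) t x :=
  derivWithin_component (g' := fun i => dt (component u i) t x) (uniqueDiffOn_Ici 0 t ht)
    (fun i => (hu.smoothEvolution_component i).hasDerivWithinAt ht x) i

theorem timeDeriv_timeDeriv_apply (hu : IsSmoothSolution a b V u₀ u₁ u) {t : ℝ} (ht : 0 ≤ t)
    (x : Plane) (i : Fin 2) :
    timeDeriv (timeDeriv u) t x i = dt (dt (component u i)) t x :=
  derivWithin_component (g' := fun i => dt (dt (component u i)) t x) (uniqueDiffOn_Ici 0 t ht)
    (fun i => ((hu.smoothEvolution_component i).dt.hasDerivWithinAt ht x).congr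
      (fun _ hs => hu.timeDeriv_apply hs x i) (hu.timeDeriv_apply ht x i)) i

theorem contDiff_slice (hu : IsSmoothSolution a b V u₀ u₁ u) {t : ℝ} (ht : 0 ≤ t) :
    ContDiff ℝ ∞ (u t) := by
  rw [← contDiffOn_univ]
  exact ContDiffOn.comp (f := fun x : Plane => (t, x)) hu.smooth (by fun_prop)
    (fun x _ => mem_halfSpace ht x)

theorem partialD_eq (hu : IsSmoothSolution a b V u₀ u₁ u) {t : ℝ} (ht : 0 ≤ t) (i j : Fin 2)
    (x : Plane) : partialD (u t) i j x = dx j (component u i) t x := by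
  have h := ((hu.contDiff_slice ht).differentiable (by simp) x).hasFDerivAt
  have h2 := ((EuclideanSpace.proj (𝕜 := ℝ) i).hasFDerivAt.comp x h).fderiv
  have h3 : component u i t = (EuclideanSpace.proj (𝕜 := ℝ) i) ∘ u t := rfl
  rw [dx, h3, h2]
  rfl

theorem divergence_eq (hu : IsSmoothSolution a b V u₀ u₁ u) {t : ℝ} (ht : 0 ≤ t) :
    divergence (u t) = (dx 0 (component u 0) + dx 1 (component u 1)) t := by
  funext x
  simp [divergence, hu.partialD_eq ht]

theorem energyDensity_eq (hu : IsSmoothSolution a b V u₀ u₁ u) {t : ℝ} (ht : 0 ≤ t)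
    (x : Plane) : energyDensity a b u t x =
      dt (component u 0) t x ^ 2 + dt (component u 1) t x ^ 2 +
      a ^ 2 * (dx 0 (component u 0) t x ^ 2 + dx 1 (component u 0) t x ^ 2 +
        (dx 0 (component u 1) t x ^ 2 + dx 1 (component u 1) t x ^ 2)) +
      (b ^ 2 - a ^ 2) * (dx 0 (component u 0) t x + dx 1 (component u 1) t x) ^ 2 := by
  rw [energyDensity, norm_sq_plane, hu.timeDeriv_apply ht, hu.timeDeriv_apply ht,
    hu.divergence_eq ht]
  simp [gradNormSq, hu.partialD_eq ht]

theorem elasticSystem (hu : IsSmoothSolution a b V u₀ u₁ u) :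
    ElasticSystem a (b ^ 2 - a ^ 2) V (component u 0) (component u 1) := by
  have h0 := hu.smoothEvolution_component 0
  have h1 := hu.smoothEvolution_component 1
  have hlap : ∀ i {t : ℝ}, 0 < t → ∀ x, Laplacian.laplacian (u t) x i =
      dx 0 (dx 0 (component u i)) t x + dx 1 (dx 1 (component u i)) t x := by
    intro i t ht x
    rw [← laplacian_eq_dx (hu.smoothEvolution_component i) ht.le]
    exact (((hu.contDiff_slice ht.le).of_le
      (WithTop.coe_le_coe.2 (le_top (a := (2 : ℕ∞))))).contDiffAt.laplacian_CLM_comp_left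
      (l := EuclideanSpace.proj (𝕜 := ℝ) i)).symm
  have hgrad : ∀ i {t : ℝ}, 0 < t → ∀ x, gradient (divergence (u t)) x i =
      dx i (dx 0 (component u 0)) t x + dx i (dx 1 (component u 1)) t x := by
    intro i t ht x
    rw [gradient_apply, hu.divergence_eq ht.le]
    exact (h0.dx 0).dx_add (h1.dx 1) i ht x
  have heq : ∀ i {t : ℝ}, 0 < t → ∀ x, dt (dt (component u i)) t x =
      a ^ 2 * (dx 0 (dx 0 (component u i)) t x + dx 1 (dx 1 (component u i)) t x) +
      (b ^ 2 - a ^ 2) * (dx i (dx 0 (component u 0)) t x + dx i (dx 1 (component u 1)) t x) -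
      V x * dt (component u i) t x := by
    intro i t ht x
    have h := congrArg (fun v : Plane => v i) (hu.eqn t ht x)
    simp only [PiLp.add_apply, PiLp.sub_apply, PiLp.smul_apply, smul_eq_mul, PiLp.zero_apply,
      hu.timeDeriv_timeDeriv_apply ht.le, hu.timeDeriv_apply ht.le, hlap i ht, hgrad i ht] at h
    linarith
  exact ⟨h0, h1, fun t ht x => heq 0 ht x, fun t ht x => heq 1 ht x⟩

end IsSmoothSolution

/-! ### Elasticity operator, stress flux and energy density -/

/-- First component of the elasticity operator `a² Δ w + c ∇ div w`. -/
def elasticOp₀ (a c : ℝ) (w₀ w₁ : ℝ → Plane → ℝ) (t : ℝ) (x : Plane) : ℝ :=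
  a ^ 2 * (dx 0 (dx 0 w₀) t x + dx 1 (dx 1 w₀) t x) +
    c * (dx 0 (dx 0 w₀) t x + dx 0 (dx 1 w₁) t x)

/-- Second component of the elasticity operator `a² Δ w + c ∇ div w`. -/
def elasticOp₁ (a c : ℝ) (w₀ w₁ : ℝ → Plane → ℝ) (t : ℝ) (x : Plane) : ℝ :=
  a ^ 2 * (dx 0 (dx 0 w₁) t x + dx 1 (dx 1 w₁) t x) +
    c * (dx 1 (dx 0 w₀) t x + dx 1 (dx 1 w₁) t x)

/-- First component of the flux of the stress of `w` tested against `v`. -/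
def flux₀ (a c : ℝ) (w₀ w₁ v₀ v₁ : ℝ → Plane → ℝ) : ℝ → Plane → ℝ :=
  (a ^ 2 • dx 0 w₀ + c • (dx 0 w₀ + dx 1 w₁)) * v₀ + (a ^ 2 • dx 0 w₁) * v₁

/-- Second component of the flux of the stress of `w` tested against `v`. -/
def flux₁ (a c : ℝ) (w₀ w₁ v₀ v₁ : ℝ → Plane → ℝ) : ℝ → Plane → ℝ :=
  (a ^ 2 • dx 1 w₀) * v₀ + (a ^ 2 • dx 1 w₁ + c • (dx 0 w₀ + dx 1 w₁)) * v₁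

/-- The bilinear elastic energy form `a² ∇w : ∇v + c div w div v`. -/
def elasticForm (a c : ℝ) (w₀ w₁ v₀ v₁ : ℝ → Plane → ℝ) : ℝ → Plane → ℝ :=
  a ^ 2 • (dx 0 w₀ * dx 0 v₀ + dx 1 w₀ * dx 1 v₀ + (dx 0 w₁ * dx 0 v₁ + dx 1 w₁ * dx 1 v₁)) +
    c • ((dx 0 w₀ + dx 1 w₁) * (dx 0 v₀ + dx 1 v₁))

section

variable {a c : ℝ} {w₀ w₁ v₀ v₁ : ℝ → Plane → ℝ}

theorem SmoothEvolution.flux₀ (hw₀ : SmoothEvolution w₀) (hw₁ : SmoothEvolution w₁)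
    (hv₀ : SmoothEvolution v₀) (hv₁ : SmoothEvolution v₁) :
    SmoothEvolution (flux₀ a c w₀ w₁ v₀ v₁) :=
  ((((hw₀.dx 0).smul _).add (((hw₀.dx 0).add (hw₁.dx 1)).smul _)).mul hv₀).add
    (((hw₁.dx 0).smul _).mul hv₁)

theorem SmoothEvolution.flux₁ (hw₀ : SmoothEvolution w₀) (hw₁ : SmoothEvolution w₁)
    (hv₀ : SmoothEvolution v₀) (hv₁ : SmoothEvolution v₁) :
    SmoothEvolution (flux₁ a c w₀ w₁ v₀ v₁) :=
  (((hw₀.dx 1).smul _).mul hv₀).add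
    ((((hw₁.dx 1).smul _).add (((hw₀.dx 0).add (hw₁.dx 1)).smul _)).mul hv₁)

theorem SmoothEvolution.elasticForm (hw₀ : SmoothEvolution w₀) (hw₁ : SmoothEvolution w₁)
    (hv₀ : SmoothEvolution v₀) (hv₁ : SmoothEvolution v₁) :
    SmoothEvolution (elasticForm a c w₀ w₁ v₀ v₁) :=
  (((((hw₀.dx 0).mul (hv₀.dx 0)).add ((hw₀.dx 1).mul (hv₀.dx 1))).add
    (((hw₁.dx 0).mul (hv₁.dx 0)).add ((hw₁.dx 1).mul (hv₁.dx 1)))).smul _).add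
    ((((hw₀.dx 0).add (hw₁.dx 1)).mul ((hv₀.dx 0).add (hv₁.dx 1))).smul _)

theorem flux₀_apply (t : ℝ) (x : Plane) : flux₀ a c w₀ w₁ v₀ v₁ t x =
    (a ^ 2 * dx 0 w₀ t x + c * (dx 0 w₀ t x + dx 1 w₁ t x)) * v₀ t x +
      a ^ 2 * dx 0 w₁ t x * v₁ t x := rfl

theorem flux₁_apply (t : ℝ) (x : Plane) : flux₁ a c w₀ w₁ v₀ v₁ t x =
    a ^ 2 * dx 1 w₀ t x * v₀ t x +
      (a ^ 2 * dx 1 w₁ t x + c * (dx 0 w₀ t x + dx 1 w₁ t x)) * v₁ t x := rfl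

theorem elasticForm_apply (t : ℝ) (x : Plane) : elasticForm a c w₀ w₁ v₀ v₁ t x =
    a ^ 2 * (dx 0 w₀ t x * dx 0 v₀ t x + dx 1 w₀ t x * dx 1 v₀ t x +
      (dx 0 w₁ t x * dx 0 v₁ t x + dx 1 w₁ t x * dx 1 v₁ t x)) +
    c * ((dx 0 w₀ t x + dx 1 w₁ t x) * (dx 0 v₀ t x + dx 1 v₁ t x)) := rfl

theorem elasticForm_self_nonneg (hc : 0 ≤ c) (t : ℝ) (x : Plane) :
    0 ≤ elasticForm a c w₀ w₁ w₀ w₁ t x := by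
  simp only [elasticForm_apply, ← sq]; positivity

/-- The flux has divergence `L w · v + B(w, v)`. -/
theorem divergence_flux (hw₀ : SmoothEvolution w₀) (hw₁ : SmoothEvolution w₁)
    (hv₀ : SmoothEvolution v₀) (hv₁ : SmoothEvolution v₁) {t : ℝ} (ht : 0 < t) (x : Plane) :
    dx 0 (flux₀ a c w₀ w₁ v₀ v₁) t x + dx 1 (flux₁ a c w₀ w₁ v₀ v₁) t x =
      elasticOp₀ a c w₀ w₁ t x * v₀ t x + elasticOp₁ a c w₀ w₁ t x * v₁ t x +
        elasticForm a c w₀ w₁ v₀ v₁ t x := by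
  have hd := (hw₀.dx 0).add (hw₁.dx 1)
  have h00 := ((hw₀.dx 0).smul (a ^ 2)).add (hd.smul c)
  have h11 := ((hw₁.dx 1).smul (a ^ 2)).add (hd.smul c)
  rw [flux₀, flux₁, SmoothEvolution.dx_add (h00.mul hv₀) (((hw₁.dx 0).smul _).mul hv₁) _ ht,
    SmoothEvolution.dx_add (((hw₀.dx 1).smul _).mul hv₀) (h11.mul hv₁) _ ht,
    h00.dx_mul hv₀ _ ht, h11.dx_mul hv₁ _ ht, ((hw₁.dx 0).smul _).dx_mul hv₁ _ ht,
    ((hw₀.dx 1).smul _).dx_mul hv₀ _ ht,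
    SmoothEvolution.dx_add ((hw₀.dx 0).smul _) (hd.smul c) _ ht,
    SmoothEvolution.dx_add ((hw₁.dx 1).smul _) (hd.smul c) _ ht,
    (hw₀.dx 0).dx_smul _ _ ht, (hw₁.dx 1).dx_smul _ _ ht, hd.dx_smul _ _ ht, hd.dx_smul _ _ ht,
    (hw₁.dx 0).dx_smul _ _ ht, (hw₀.dx 1).dx_smul _ _ ht,
    (hw₀.dx 0).dx_add (hw₁.dx 1) _ ht, (hw₀.dx 0).dx_add (hw₁.dx 1) _ ht, elasticForm_apply,
    elasticOp₀, elasticOp₁]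
  simp only [Pi.add_apply, Pi.smul_apply, smul_eq_mul]
  ring

theorem dt_sq {f : ℝ → Plane → ℝ} (hf : SmoothEvolution f) {t : ℝ} (ht : 0 < t) (x : Plane) :
    dt (f * f) t x = 2 * (f t x * dt f t x) := by
  rw [hf.dt_mul hf ht]; ring

/-- Symmetry of the form gives the factor 2; `dt` passes inside because it commutes with `dx`. -/
theorem dt_elasticForm_self (hw₀ : SmoothEvolution w₀) (hw₁ : SmoothEvolution w₁) {t : ℝ}
    (ht : 0 < t) (x : Plane) :
    dt (elasticForm a c w₀ w₁ w₀ w₁) t x =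
      2 * elasticForm a c w₀ w₁ (dt w₀) (dt w₁) t x := by
  have hd := (hw₀.dx 0).add (hw₁.dx 1)
  have h0 := ((hw₀.dx 0).mul (hw₀.dx 0)).add ((hw₀.dx 1).mul (hw₀.dx 1))
  have h1 := ((hw₁.dx 0).mul (hw₁.dx 0)).add ((hw₁.dx 1).mul (hw₁.dx 1))
  rw [elasticForm_apply, elasticForm,
    SmoothEvolution.dt_add ((h0.add h1).smul _) ((hd.mul hd).smul _) ht,
    (h0.add h1).dt_smul _ ht, (hd.mul hd).dt_smul _ ht, h0.dt_add h1 ht,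
    SmoothEvolution.dt_add ((hw₀.dx 0).mul (hw₀.dx 0)) ((hw₀.dx 1).mul (hw₀.dx 1)) ht,
    SmoothEvolution.dt_add ((hw₁.dx 0).mul (hw₁.dx 0)) ((hw₁.dx 1).mul (hw₁.dx 1)) ht,
    dt_sq (hw₀.dx 0) ht, dt_sq (hw₀.dx 1) ht, dt_sq (hw₁.dx 0) ht, dt_sq (hw₁.dx 1) ht,
    dt_sq hd ht, (hw₀.dx 0).dt_add (hw₁.dx 1) ht, hw₀.dt_dx _ ht.le, hw₀.dt_dx _ ht.le,
    hw₁.dt_dx _ ht.le, hw₁.dt_dx _ ht.le]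
  simp only [Pi.add_apply]
  ring

end

/-- Twice the total energy density `|w_t|² + a² |∇w|² + c (div w)²`. -/
def elasticDensity (a c : ℝ) (w₀ w₁ : ℝ → Plane → ℝ) : ℝ → Plane → ℝ :=
  dt w₀ * dt w₀ + dt w₁ * dt w₁ + elasticForm a c w₀ w₁ w₀ w₁

theorem elasticDensity_apply (a c : ℝ) (w₀ w₁ : ℝ → Plane → ℝ) (t : ℝ) (x : Plane) :
    elasticDensity a c w₀ w₁ t x =
      dt w₀ t x * dt w₀ t x + dt w₁ t x * dt w₁ t x + elasticForm a c w₀ w₁ w₀ w₁ t x := rfl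

/-! ### Finite speed of propagation -/

/-- The energy flux through a direction `y` is at most `b |y|` times the energy density. -/
theorem two_flux_le {a b c r y₀ y₁ p₀ p₁ m₀₀ m₀₁ m₁₀ m₁₁ : ℝ} (hc : 0 ≤ c)
    (hab : a ^ 2 + c = b ^ 2) (hb : 0 < b) (hr : 0 < r) (hy : y₀ ^ 2 + y₁ ^ 2 ≤ r ^ 2) :
    2 * (y₀ * ((a ^ 2 * m₀₀ + c * (m₀₀ + m₁₁)) * p₀ + a ^ 2 * m₁₀ * p₁) +
      y₁ * (a ^ 2 * m₀₁ * p₀ + (a ^ 2 * m₁₁ + c * (m₀₀ + m₁₁)) * p₁)) ≤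
    b * r * (p₀ * p₀ + p₁ * p₁ + (a ^ 2 * (m₀₀ * m₀₀ + m₀₁ * m₀₁ + (m₁₀ * m₁₀ + m₁₁ * m₁₁)) +
      c * ((m₀₀ + m₁₁) * (m₀₀ + m₁₁)))) := by
  have hbr : 0 < b * r := mul_pos hb hr
  have hcs : (y₀ * p₀ + y₁ * p₁) ^ 2 ≤ r ^ 2 * (p₀ ^ 2 + p₁ ^ 2) :=
    calc (y₀ * p₀ + y₁ * p₁) ^ 2 ≤ (y₀ ^ 2 + y₁ ^ 2) * (p₀ ^ 2 + p₁ ^ 2) := by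
          nlinarith [sq_nonneg (y₀ * p₁ - y₁ * p₀)]
      _ ≤ _ := by gcongr
  -- The gradient part needs one square per matrix entry; the divergence part below needs a single
  -- square together with `hcs`.
  have h1 : 2 * (b * r) * (m₀₀ * y₀ * p₀ + m₀₁ * y₁ * p₀ + m₁₀ * y₀ * p₁ + m₁₁ * y₁ * p₁) ≤
      (b * r) ^ 2 * (m₀₀ ^ 2 + m₀₁ ^ 2 + m₁₀ ^ 2 + m₁₁ ^ 2) + r ^ 2 * (p₀ ^ 2 + p₁ ^ 2) := by
    have : (y₀ ^ 2 + y₁ ^ 2) * (p₀ ^ 2 + p₁ ^ 2) ≤ r ^ 2 * (p₀ ^ 2 + p₁ ^ 2) := by gcongr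
    linarith [sq_nonneg (b * r * m₀₀ - y₀ * p₀), sq_nonneg (b * r * m₀₁ - y₁ * p₀),
      sq_nonneg (b * r * m₁₀ - y₀ * p₁), sq_nonneg (b * r * m₁₁ - y₁ * p₁)]
  have h2 : 2 * (b * r) * ((m₀₀ + m₁₁) * (y₀ * p₀ + y₁ * p₁)) ≤
      (b * r) ^ 2 * (m₀₀ + m₁₁) ^ 2 + r ^ 2 * (p₀ ^ 2 + p₁ ^ 2) := by
    linarith [sq_nonneg (b * r * (m₀₀ + m₁₁) - (y₀ * p₀ + y₁ * p₁))]
  -- The weights a² and c add up to b², so everything carries a common factor b r, cancelled at the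
  -- end.
  have h3 := add_le_add (mul_le_mul_of_nonneg_left h1 (sq_nonneg a))
    (mul_le_mul_of_nonneg_left h2 hc)
  have h4 : a ^ 2 * (r ^ 2 * (p₀ ^ 2 + p₁ ^ 2)) + c * (r ^ 2 * (p₀ ^ 2 + p₁ ^ 2)) =
      (b * r) ^ 2 * (p₀ ^ 2 + p₁ ^ 2) := by rw [← add_mul, hab]; ring
  refine le_of_mul_le_mul_left ?_ hbr
  linarith

/-- A smooth cutoff supported in the backward light cone of slope `b` with vertex `(T, z)`. -/
def coneCutoff (b T : ℝ) (z : Plane) (t : ℝ) (x : Plane) : ℝ :=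
  expNegInvGlue (b ^ 2 * (T - t) ^ 2 - ((x 0 - z 0) ^ 2 + (x 1 - z 1) ^ 2))

theorem deriv_expNegInvGlue_nonneg (y : ℝ) : 0 ≤ deriv expNegInvGlue y :=
  expNegInvGlue.monotone.deriv_nonneg

/-- Such a point is a global minimum, since the function is nonnegative and vanishes there. -/
theorem deriv_expNegInvGlue_of_nonpos {y : ℝ} (hy : y ≤ 0) : deriv expNegInvGlue y = 0 := by
  refine IsLocalMin.deriv_eq_zero (Eventually.of_forall fun z => ?_)
  rw [expNegInvGlue.zero_of_nonpos hy]
  exact expNegInvGlue.nonneg z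

theorem smoothEvolution_coneCutoff (b T : ℝ) (z : Plane) :
    SmoothEvolution (coneCutoff b T z) := by
  have h : ∀ j, ContDiff ℝ ∞ fun p : ℝ × Plane => p.2 j := fun j =>
    (contDiff_coord j).comp contDiff_snd
  refine ContDiff.contDiffOn (expNegInvGlue.contDiff.comp ?_)
  have h0 := h 0
  have h1 := h 1
  fun_prop

theorem dt_coneCutoff (b T : ℝ) (z : Plane) {t : ℝ} (ht : 0 < t) (x : Plane) :
    dt (coneCutoff b T z) t x = -(2 * b ^ 2 * (T - t)) *
      deriv expNegInvGlue (b ^ 2 * (T - t) ^ 2 - ((x 0 - z 0) ^ 2 + (x 1 - z 1) ^ 2)) := by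
  have hin : HasDerivAt (fun s => b ^ 2 * (T - s) ^ 2 - ((x 0 - z 0) ^ 2 + (x 1 - z 1) ^ 2))
      (-(2 * b ^ 2 * (T - t))) t := by
    refine (((((hasDerivAt_id t).const_sub T).pow 2).const_mul (b ^ 2)).sub_const _).congr_deriv ?_
    simp; ring
  have hout := ((expNegInvGlue.contDiff (n := 1)).differentiable one_ne_zero
    (b ^ 2 * (T - t) ^ 2 - ((x 0 - z 0) ^ 2 + (x 1 - z 1) ^ 2))).hasDerivAt
  rw [((smoothEvolution_coneCutoff b T z).hasDerivAt ht x).unique (hout.comp t hin)]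
  ring

theorem dx_coneCutoff (b T : ℝ) (z : Plane) (j : Fin 2) (t : ℝ) (x : Plane) :
    dx j (coneCutoff b T z) t x = -(2 * (x j - z j)) *
      deriv expNegInvGlue (b ^ 2 * (T - t) ^ 2 - ((x 0 - z 0) ^ 2 + (x 1 - z 1) ^ 2)) := by
  have hin := ((((hasFDerivAt_coord 0 x).sub_const (z 0)).pow 2).add
    (((hasFDerivAt_coord 1 x).sub_const (z 1)).pow 2)).const_sub (b ^ 2 * (T - t) ^ 2)
  have hout := ((expNegInvGlue.contDiff (n := 1)).differentiable one_ne_zero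
    (b ^ 2 * (T - t) ^ 2 - ((x 0 - z 0) ^ 2 + (x 1 - z 1) ^ 2))).hasDerivAt
  have h := hout.comp_hasFDerivAt x hin
  have h' : fderiv ℝ (coneCutoff b T z t) x = _ := h.fderiv
  rw [dx, h']
  fin_cases j <;> simp [coordVec] <;> ring

namespace ElasticSystem

variable {a b c L : ℝ} {V : Plane → ℝ} {w₀ w₁ : ℝ → Plane → ℝ}

theorem smoothEvolution_elasticDensity (h : ElasticSystem a c V w₀ w₁) :
    SmoothEvolution (elasticDensity a c w₀ w₁) :=
  ((h.smooth₀.dt.mul h.smooth₀.dt).add (h.smooth₁.dt.mul h.smooth₁.dt)).add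
    (h.smooth₀.elasticForm h.smooth₁ h.smooth₀ h.smooth₁)

theorem elasticDensity_nonneg (hc : 0 ≤ c) (t : ℝ) (x : Plane) :
    0 ≤ elasticDensity a c w₀ w₁ t x := by
  rw [elasticDensity_apply]
  have := elasticForm_self_nonneg (a := a) (w₀ := w₀) (w₁ := w₁) hc t x
  nlinarith [mul_self_nonneg (dt w₀ t x), mul_self_nonneg (dt w₁ t x)]

/-- By `divergence_flux` the terms without `V` form twice the divergence of the flux tested against
w_t, so only the damping dissipates. -/
theorem dt_elasticDensity (h : ElasticSystem a c V w₀ w₁) {t : ℝ} (ht : 0 < t) (x : Plane) :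
    dt (elasticDensity a c w₀ w₁) t x =
      2 * (elasticOp₀ a c w₀ w₁ t x * dt w₀ t x + elasticOp₁ a c w₀ w₁ t x * dt w₁ t x +
        elasticForm a c w₀ w₁ (dt w₀) (dt w₁) t x -
        V x * (dt w₀ t x ^ 2 + dt w₁ t x ^ 2)) := by
  rw [elasticDensity, SmoothEvolution.dt_add ((h.smooth₀.dt.mul h.smooth₀.dt).add
    (h.smooth₁.dt.mul h.smooth₁.dt)) (h.smooth₀.elasticForm h.smooth₁ h.smooth₀ h.smooth₁) ht,
    SmoothEvolution.dt_add (h.smooth₀.dt.mul h.smooth₀.dt) (h.smooth₁.dt.mul h.smooth₁.dt) ht,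
    dt_sq h.smooth₀.dt ht, dt_sq h.smooth₁.dt ht, dt_elasticForm_self h.smooth₀ h.smooth₁ ht,
    h.eqn₀ t ht, h.eqn₁ t ht, elasticOp₀, elasticOp₁]
  ring

/-- The energy localized in a backward light cone vanishes if the data vanish on its base. -/
theorem cone_density_eq_zero (h : ElasticSystem a c V w₀ w₁) (hc : 0 ≤ c)
    (hab : a ^ 2 + c = b ^ 2) (hb : 0 < b) (hV : ∀ x, 0 ≤ V x)
    (hw₀ : ∀ x, L < ‖x‖ → w₀ 0 x = 0) (hw₁ : ∀ x, L < ‖x‖ → w₁ 0 x = 0)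
    (hp₀ : ∀ x, L < ‖x‖ → dt w₀ 0 x = 0) (hp₁ : ∀ x, L < ‖x‖ → dt w₁ 0 x = 0)
    {T : ℝ} {z : Plane} (hz : L + b * T < ‖z‖) {t : ℝ} (ht : t ∈ Ioo 0 T) :
    elasticDensity a c w₀ w₁ t z = 0 := by
  have hT : 0 < T := ht.1.trans ht.2
  have hχ := smoothEvolution_coneCutoff b T z
  have hE := h.smoothEvolution_elasticDensity
  have hF₀ := h.smooth₀.flux₀ (a := a) (c := c) h.smooth₁ h.smooth₀.dt h.smooth₁.dt
  have hF₁ := h.smooth₀.flux₁ (a := a) (c := c) h.smooth₁ h.smooth₀.dt h.smooth₁.dt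
  have hdist : ∀ x : Plane, ‖x - z‖ ^ 2 = (x 0 - z 0) ^ 2 + (x 1 - z 1) ^ 2 := fun x => by
    rw [norm_sq_plane]; rfl
  have hχ0 : ∀ s ∈ Icc 0 t, ∀ x ∉ Metric.closedBall z (b * T), coneCutoff b T z s x = 0 := by
    intro s hs x hx
    refine expNegInvGlue.zero_of_nonpos ?_
    rw [← hdist, sub_nonpos, ← mul_pow]
    have hx' : b * T < ‖x - z‖ := by simpa [dist_eq_norm] using hx
    have h1 : b * (T - s) ≤ b * T := by nlinarith [hs.1]
    have h2 : 0 ≤ b * (T - s) := mul_nonneg hb.le (by linarith [hs.2, ht.2])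
    gcongr
    linarith
  -- The energy weighted by the cutoff is nonincreasing: the cutoff decays in time fast enough to
  -- dominate the flux through its spatial gradient, and the damping has a favourable sign.
  have hmono := integral_le_integral_initial (e := coneCutoff b T z * elasticDensity a c w₀ w₁)
    (h₀ := (2 : ℝ) • (coneCutoff b T z * flux₀ a c w₀ w₁ (dt w₀) (dt w₁)))
    (h₁ := (2 : ℝ) • (coneCutoff b T z * flux₁ a c w₀ w₁ (dt w₀) (dt w₁)))
    (hχ.mul hE) ((hχ.mul hF₀).smul 2) ((hχ.mul hF₁).smul 2) ht.1.le
    (isCompact_closedBall z (b * T))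
    (fun s hs x hx => by simp [hχ0 s hs x hx]) (fun s hs x hx => by simp [hχ0 s hs x hx])
    (fun s hs x hx => by simp [hχ0 s hs x hx]) (by
      intro s hs x
      have hs0 := hs.1
      rw [hχ.dt_mul hE hs0, (hχ.mul hF₀).dx_smul _ _ hs0, (hχ.mul hF₁).dx_smul _ _ hs0,
        hχ.dx_mul hF₀ _ hs0, hχ.dx_mul hF₁ _ hs0, h.dt_elasticDensity hs0,
        dt_coneCutoff b T z hs0, dx_coneCutoff, dx_coneCutoff]
      have hdiv := divergence_flux (a := a) (c := c) h.smooth₀ h.smooth₁ h.smooth₀.dt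
        h.smooth₁.dt hs0 x
      set y := b ^ 2 * (T - s) ^ 2 - ((x 0 - z 0) ^ 2 + (x 1 - z 1) ^ 2) with hy
      set γ := deriv expNegInvGlue y with hγ
      have hkey : 2 * ((x 0 - z 0) * flux₀ a c w₀ w₁ (dt w₀) (dt w₁) s x +
          (x 1 - z 1) * flux₁ a c w₀ w₁ (dt w₀) (dt w₁) s x) * γ ≤
          b ^ 2 * (T - s) * elasticDensity a c w₀ w₁ s x * γ := by
        -- Outside the cone the derivative of the cutoff profile vanishes. Inside, |x - z| < b (T -
        -- s), which is the radius given to `two_flux_le`.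
        rcases le_or_gt y 0 with hy0 | hy0
        · rw [hγ, deriv_expNegInvGlue_of_nonpos hy0]; simp
        · refine mul_le_mul_of_nonneg_right ?_ (deriv_expNegInvGlue_nonneg y)
          have hTs : 0 < T - s := by linarith [hs.2, ht.2]
          rw [flux₀_apply, flux₁_apply, elasticDensity_apply, elasticForm_apply]
          refine (two_flux_le (r := b * (T - s)) hc hab hb (mul_pos hb hTs) ?_).trans_eq
            (by ring)
          rw [mul_pow]; linarith
      have hχs : 0 ≤ coneCutoff b T z s x := expNegInvGlue.nonneg _
      have hVχ : 0 ≤ coneCutoff b T z s x * (V x * (dt w₀ s x ^ 2 + dt w₁ s x ^ 2)) :=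
        mul_nonneg hχs (mul_nonneg (hV x) (by positivity))
      have hdivχ := congrArg (fun r => coneCutoff b T z s x * r) hdiv
      beta_reduce at hdivχ
      linarith)
  -- The data vanish for |x| > L, and since |z| > L + bT the base of the cone misses the ball |x| ≤
  -- L.
  have he0 : ∀ x, (coneCutoff b T z * elasticDensity a c w₀ w₁) 0 x = 0 := by
    intro x
    by_cases hx : L < ‖x‖
    · have hvan : ∀ {w : ℝ → Plane → ℝ}, (∀ x, L < ‖x‖ → w 0 x = 0) → ∀ j, dx j w 0 x = 0 := by
        intro w hw j
        rw [dx, fderiv_eq_zero_of_vanish (K := Metric.closedBall 0 L) Metric.isClosed_closedBall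
          (fun x hx => hw x (by simpa using hx)) (by simpa using hx)]
        rfl
      simp [elasticDensity_apply, elasticForm_apply, hvan hw₀, hvan hw₁, hp₀ x hx, hp₁ x hx]
    · have : x ∉ Metric.closedBall z (b * T) := by
        intro hx'
        rw [Metric.mem_closedBall, dist_eq_norm] at hx'
        have := norm_sub_norm_le z x
        rw [norm_sub_rev] at this
        linarith
      simp [hχ0 0 ⟨le_rfl, ht.1.le⟩ x this]
  simp only [he0, integral_zero] at hmono
  have hnn : ∀ x, 0 ≤ (coneCutoff b T z * elasticDensity a c w₀ w₁) t x := fun x =>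
    mul_nonneg (expNegInvGlue.nonneg _) (elasticDensity_nonneg hc t x)
  have hcont := (hχ.mul hE).continuous_slice ht.1.le
  have hint := integrable_of_vanish hcont (isCompact_closedBall z (b * T)) fun x hx => by
    simp [hχ0 t ⟨ht.1.le, le_rfl⟩ x hx]
  -- A continuous nonnegative function with zero integral vanishes everywhere, in particular on the
  -- axis of the cone, where the cutoff is positive.
  have hz0 := (integral_eq_zero_iff_of_nonneg hnn hint).1
    (le_antisymm hmono (integral_nonneg hnn))
  have hz1 := congrFun ((hcont.ae_eq_iff_eq volume continuous_const).1 hz0) z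
  have hχz : 0 < coneCutoff b T z t z := by
    refine expNegInvGlue.pos_of_pos ?_
    have : 0 < T - t := by linarith [ht.2]
    have hpos : 0 < b ^ 2 * (T - t) ^ 2 := by positivity
    linarith [sub_self (z 0), sub_self (z 1),
      show (z 0 - z 0) ^ 2 + (z 1 - z 1) ^ 2 = 0 by ring]
  exact (mul_eq_zero.1 hz1).resolve_left hχz.ne'

/-- Finite speed of propagation. -/
theorem eq_zero_of_far (h : ElasticSystem a c V w₀ w₁) (hc : 0 ≤ c)
    (hab : a ^ 2 + c = b ^ 2) (hb : 0 < b) (hV : ∀ x, 0 ≤ V x)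
    (hw₀ : ∀ x, L < ‖x‖ → w₀ 0 x = 0) (hw₁ : ∀ x, L < ‖x‖ → w₁ 0 x = 0)
    (hp₀ : ∀ x, L < ‖x‖ → dt w₀ 0 x = 0) (hp₁ : ∀ x, L < ‖x‖ → dt w₁ 0 x = 0)
    {T : ℝ} (hT : 0 ≤ T) {z : Plane} (hz : L + b * T < ‖z‖) : w₀ T z = 0 ∧ w₁ T z = 0 := by
  have hL : L < ‖z‖ := by nlinarith
  -- The density vanishes along the axis over `z`, hence so does w_t, and w keeps its initial value
  -- up to time `T`.
  have hdt : ∀ t ∈ Ioo 0 T, dt w₀ t z = 0 ∧ dt w₁ t z = 0 := by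
    intro t ht
    have h0 := h.cone_density_eq_zero hc hab hb hV hw₀ hw₁ hp₀ hp₁ hz ht
    rw [elasticDensity_apply] at h0
    have := elasticForm_self_nonneg (a := a) (w₀ := w₀) (w₁ := w₁) hc t z
    have h1 := mul_self_nonneg (dt w₀ t z)
    have h2 := mul_self_nonneg (dt w₁ t z)
    exact ⟨mul_self_eq_zero.1 (by linarith), mul_self_eq_zero.1 (by linarith)⟩
  exact ⟨(h.smooth₀.eq_initial_of_dt_eq_zero hT fun t ht => (hdt t ht).1).trans (hw₀ z hL),
    (h.smooth₁.eq_initial_of_dt_eq_zero hT fun t ht => (hdt t ht).2).trans (hw₁ z hL)⟩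

end ElasticSystem

/-! ### Propagation of supports and the equation integrated in time -/

theorem dx_congr_slice {f g : ℝ → Plane → ℝ} {t : ℝ} (h : f t = g t) (j : Fin 2) :
    dx j f t = dx j g t := by
  funext x; rw [dx, dx, h]

theorem primitive_zero (f : ℝ → Plane → ℝ) : primitive f 0 = 0 := by
  funext x; simp [primitive]

theorem dx_eq_zero_of_slice {f : ℝ → Plane → ℝ} {t : ℝ} (h : f t = 0) (j : Fin 2) :
    dx j f t = 0 := by
  funext x; rw [dx, h]; simp

/-- Vanishing outside the ball of radius `L + b t`. -/
def FarZero (L b : ℝ) (f : ℝ → Plane → ℝ) : Prop :=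
  ∀ t, 0 ≤ t → ∀ x, L + b * t < ‖x‖ → f t x = 0

namespace FarZero

variable {L b : ℝ} {f : ℝ → Plane → ℝ}

protected theorem dx (hf : FarZero L b f) (j : Fin 2) : FarZero L b (dx j f) := by
  intro t ht x hx
  rw [_root_.dx, fderiv_eq_zero_of_vanish (K := Metric.closedBall 0 (L + b * t))
    Metric.isClosed_closedBall (fun x hx => hf t ht x (by simpa using hx)) (by simpa using hx)]
  rfl

protected theorem dt (hf : FarZero L b f) : FarZero L b (dt f) := by
  intro t ht x hx
  have hnear : ∀ᶠ s in nhds t, L + b * s < ‖x‖ :=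
    (by fun_prop : Continuous fun s : ℝ => L + b * s).continuousAt.eventually_lt_const hx
  have : (fun s => f s x) =ᶠ[nhdsWithin t (Ici 0)] fun _ => 0 := by
    filter_upwards [nhdsWithin_le_nhds hnear, self_mem_nhdsWithin] with s hs hs0
      using hf s hs0 x hs
  rw [_root_.dt, this.derivWithin_eq (hf t ht x hx)]
  simp

protected theorem primitive (hf : FarZero L b f) (hb : 0 ≤ b) : FarZero L b (primitive f) := by
  intro t ht x hx
  rw [_root_.primitive]
  refine (intervalIntegral.integral_congr (g := fun _ => 0) fun s hs => ?_).trans (by simp)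
  rw [uIcc_of_le ht] at hs
  exact hf s hs.1 x (by nlinarith [hs.2])

end FarZero

namespace SmoothEvolution

variable {f : ℝ → Plane → ℝ}

theorem dx_dt_primitive (hf : SmoothEvolution f) (j : Fin 2) {t : ℝ} (ht : 0 ≤ t) :
    _root_.dx j (_root_.dt (_root_.primitive f)) t = _root_.dx j f t :=
  dx_congr_slice (funext fun x => hf.dt_primitive ht x) j

theorem dt_dx_dx_primitive (hf : SmoothEvolution f) (j k : Fin 2) {t : ℝ} (ht : 0 ≤ t)
    (x : Plane) :
    _root_.dt (_root_.dx j (_root_.dx k (_root_.primitive f))) t x =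
      _root_.dx j (_root_.dx k f) t x := by
  rw [(hf.primitive.dx k).dt_dx j ht]
  refine congrFun (dx_congr_slice (funext fun y => ?_) j) x
  rw [hf.primitive.dt_dx k ht, hf.dx_dt_primitive k ht]

end SmoothEvolution

theorem dx_dx_primitive_zero (f : ℝ → Plane → ℝ) (j k : Fin 2) (x : Plane) :
    dx j (dx k (primitive f)) 0 x = 0 := by
  rw [dx_eq_zero_of_slice (dx_eq_zero_of_slice (primitive_zero f) k) j]; rfl

/-- The source `w_t(0) + V w(0)` of the equation for the time primitive. -/
def forcing (V : Plane → ℝ) (w : ℝ → Plane → ℝ) (x : Plane) : ℝ := dt w 0 x + V x * w 0 x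

theorem contDiff_forcing {V : Plane → ℝ} (hV : ContDiff ℝ ∞ V) {w : ℝ → Plane → ℝ}
    (hw : SmoothEvolution w) : ContDiff ℝ ∞ (forcing V w) :=
  (hw.dt.contDiff_slice le_rfl).add (hV.mul (hw.contDiff_slice le_rfl))

namespace ElasticSystem

variable {a c : ℝ} {V : Plane → ℝ} {w₀ w₁ : ℝ → Plane → ℝ}

/-- The equation integrated in time, first component. -/
theorem dt_eq_integrated₀ (h : ElasticSystem a c V w₀ w₁) (hV : ContDiff ℝ ∞ V) {t : ℝ}
    (ht : 0 ≤ t) (x : Plane) :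
    dt w₀ t x = forcing V w₀ x - V x * w₀ t x +
      elasticOp₀ a c (primitive w₀) (primitive w₁) t x := by
  have hs := h.smooth₀
  have hU₀ := h.smooth₀.primitive
  have hU₁ := h.smooth₁.primitive
  have hVs := SmoothEvolution.of_space hV
  have hA := ((hU₀.dx 0).dx 0).add ((hU₀.dx 1).dx 1)
  have hB := ((hU₀.dx 0).dx 0).add ((hU₁.dx 1).dx 0)
  -- The residue w_t + V w - (elasticity operator of U). Its time derivative is zero by the
  -- equation, and at t = 0 the operator term vanishes with U, leaving the forcing.
  let R := dt w₀ + (fun _ => V) * w₀ -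
    (a ^ 2 • (dx 0 (dx 0 (primitive w₀)) + dx 1 (dx 1 (primitive w₀))) +
      c • (dx 0 (dx 0 (primitive w₀)) + dx 0 (dx 1 (primitive w₁))))
  have hR : SmoothEvolution R := (hs.dt.add (hVs.mul hs)).sub ((hA.smul _).add (hB.smul _))
  have key : R t x = R 0 x := by
    refine hR.eq_initial_of_dt_eq_zero ht fun s hs' => ?_
    have hs0 := hs'.1
    rw [SmoothEvolution.dt_sub (hs.dt.add (hVs.mul hs)) ((hA.smul _).add (hB.smul _)) hs0,
      hs.dt.dt_add (hVs.mul hs) hs0, hVs.dt_mul hs hs0, (hA.smul _).dt_add (hB.smul _) hs0,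
      hA.dt_smul _ hs0, hB.dt_smul _ hs0, SmoothEvolution.dt_add _ _ hs0,
      SmoothEvolution.dt_add _ _ hs0, dt_of_space, h.eqn₀ s hs0]
    · simp only [h.smooth₀.dt_dx_dx_primitive _ _ hs0.le, h.smooth₁.dt_dx_dx_primitive _ _ hs0.le]
      ring
    exacts [(hU₀.dx 0).dx 0, (hU₁.dx 1).dx 0, (hU₀.dx 0).dx 0, (hU₀.dx 1).dx 1]
  simp only [R, Pi.add_apply, Pi.sub_apply, Pi.mul_apply, Pi.smul_apply, smul_eq_mul,
    dx_dx_primitive_zero] at key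
  rw [forcing, elasticOp₀]
  linarith

/-- The equation integrated in time, second component. -/
theorem dt_eq_integrated₁ (h : ElasticSystem a c V w₀ w₁) (hV : ContDiff ℝ ∞ V) {t : ℝ}
    (ht : 0 ≤ t) (x : Plane) :
    dt w₁ t x = forcing V w₁ x - V x * w₁ t x +
      elasticOp₁ a c (primitive w₀) (primitive w₁) t x := by
  have hs := h.smooth₁
  have hU₀ := h.smooth₀.primitive
  have hU₁ := h.smooth₁.primitive
  have hVs := SmoothEvolution.of_space hV
  have hA := ((hU₁.dx 0).dx 0).add ((hU₁.dx 1).dx 1)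
  have hB := ((hU₀.dx 0).dx 1).add ((hU₁.dx 1).dx 1)
  let R := dt w₁ + (fun _ => V) * w₁ -
    (a ^ 2 • (dx 0 (dx 0 (primitive w₁)) + dx 1 (dx 1 (primitive w₁))) +
      c • (dx 1 (dx 0 (primitive w₀)) + dx 1 (dx 1 (primitive w₁))))
  have hR : SmoothEvolution R := (hs.dt.add (hVs.mul hs)).sub ((hA.smul _).add (hB.smul _))
  have key : R t x = R 0 x := by
    refine hR.eq_initial_of_dt_eq_zero ht fun s hs' => ?_
    have hs0 := hs'.1
    rw [SmoothEvolution.dt_sub (hs.dt.add (hVs.mul hs)) ((hA.smul _).add (hB.smul _)) hs0,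
      hs.dt.dt_add (hVs.mul hs) hs0, hVs.dt_mul hs hs0, (hA.smul _).dt_add (hB.smul _) hs0,
      hA.dt_smul _ hs0, hB.dt_smul _ hs0, SmoothEvolution.dt_add _ _ hs0,
      SmoothEvolution.dt_add _ _ hs0, dt_of_space, h.eqn₁ s hs0]
    · simp only [h.smooth₀.dt_dx_dx_primitive _ _ hs0.le, h.smooth₁.dt_dx_dx_primitive _ _ hs0.le]
      ring
    exacts [(hU₀.dx 0).dx 1, (hU₁.dx 1).dx 1, (hU₁.dx 0).dx 0, (hU₁.dx 1).dx 1]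
  simp only [R, Pi.add_apply, Pi.sub_apply, Pi.mul_apply, Pi.smul_apply, smul_eq_mul,
    dx_dx_primitive_zero] at key
  rw [forcing, elasticOp₁]
  linarith

end ElasticSystem

/-! ### Multiplier energy and energy of the time primitive -/

/-- Density of the weighted energy: multipliers `f w_t + g w` with `g' = k`, damped by `V`. -/
def multiplierDensity (a c : ℝ) (V : Plane → ℝ) (f g k : ℝ → ℝ) (w₀ w₁ : ℝ → Plane → ℝ) :
    ℝ → Plane → ℝ :=
  (1 / 2 : ℝ) • ((fun t _ => f t) * elasticDensity a c w₀ w₁) +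
    (fun t _ => g t) * (w₀ * dt w₀ + w₁ * dt w₁) +
    (1 / 2 : ℝ) • (((fun t _ => g t) * (fun _ => V) - fun t _ => k t) * (w₀ * w₀ + w₁ * w₁))

/-- Density `½ |w|² + ½ B(U, U) - F · U` of the energy of the time primitive `U` of `w`. -/
def primitiveDensity (a c : ℝ) (V : Plane → ℝ) (w₀ w₁ : ℝ → Plane → ℝ) : ℝ → Plane → ℝ :=
  (1 / 2 : ℝ) • (w₀ * w₀ + w₁ * w₁) +
    (1 / 2 : ℝ) • elasticForm a c (primitive w₀) (primitive w₁) (primitive w₀) (primitive w₁) -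
    ((fun _ => forcing V w₀) * primitive w₀ + (fun _ => forcing V w₁) * primitive w₁)

theorem multiplierDensity_apply (a c : ℝ) (V : Plane → ℝ) (f g k : ℝ → ℝ)
    (w₀ w₁ : ℝ → Plane → ℝ) (t : ℝ) (x : Plane) :
    multiplierDensity a c V f g k w₀ w₁ t x =
      1 / 2 * (f t * elasticDensity a c w₀ w₁ t x) +
      g t * (w₀ t x * dt w₀ t x + w₁ t x * dt w₁ t x) +
      1 / 2 * ((g t * V x - k t) * (w₀ t x * w₀ t x + w₁ t x * w₁ t x)) := rfl

theorem primitiveDensity_apply (a c : ℝ) (V : Plane → ℝ) (w₀ w₁ : ℝ → Plane → ℝ) (t : ℝ)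
    (x : Plane) : primitiveDensity a c V w₀ w₁ t x =
      1 / 2 * (w₀ t x * w₀ t x + w₁ t x * w₁ t x) +
      1 / 2 * elasticForm a c (primitive w₀) (primitive w₁) (primitive w₀) (primitive w₁) t x -
      (forcing V w₀ x * primitive w₀ t x + forcing V w₁ x * primitive w₁ t x) := rfl

namespace ElasticSystem

variable {a c : ℝ} {V : Plane → ℝ} {w₀ w₁ : ℝ → Plane → ℝ}

theorem smoothEvolution_multiplierDensity (h : ElasticSystem a c V w₀ w₁) (hV : ContDiff ℝ ∞ V)
    {f g k : ℝ → ℝ} (hf : ContDiffOn ℝ ∞ f (Ici 0)) (hg : ContDiffOn ℝ ∞ g (Ici 0))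
    (hk : ContDiffOn ℝ ∞ k (Ici 0)) :
    SmoothEvolution (multiplierDensity a c V f g k w₀ w₁) := by
  have hp := (h.smooth₀.mul h.smooth₀.dt).add (h.smooth₁.mul h.smooth₁.dt)
  have hw := (h.smooth₀.mul h.smooth₀).add (h.smooth₁.mul h.smooth₁)
  have hg' := SmoothEvolution.of_time hg
  exact ((((SmoothEvolution.of_time hf).mul h.smoothEvolution_elasticDensity).smul _).add
    (hg'.mul hp)).add ((((hg'.mul (.of_space hV)).sub (.of_time hk)).mul hw).smul _)

theorem smoothEvolution_primitiveDensity (h : ElasticSystem a c V w₀ w₁)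
    (hV : ContDiff ℝ ∞ V) : SmoothEvolution (primitiveDensity a c V w₀ w₁) := by
  have hw := (h.smooth₀.mul h.smooth₀).add (h.smooth₁.mul h.smooth₁)
  have hU₀ := h.smooth₀.primitive
  have hU₁ := h.smooth₁.primitive
  exact ((hw.smul _).add ((hU₀.elasticForm hU₁ hU₀ hU₁).smul _)).sub
    (((SmoothEvolution.of_space (contDiff_forcing hV h.smooth₀)).mul hU₀).add
      ((SmoothEvolution.of_space (contDiff_forcing hV h.smooth₁)).mul hU₁))

/-- The summand ½ (g V - k) |w|² of the density is designed so that its derivative cancels the cross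
terms w·w_t produced by g w·w_t. The first two groups on the right are flux divergences. -/
theorem dt_multiplierDensity (h : ElasticSystem a c V w₀ w₁) (hV : ContDiff ℝ ∞ V)
    {f g k : ℝ → ℝ} (hf : ContDiffOn ℝ ∞ f (Ici 0)) (hg : ContDiffOn ℝ ∞ g (Ici 0))
    (hk : ContDiffOn ℝ ∞ k (Ici 0)) {t : ℝ} (ht : 0 < t) (hgk : HasDerivAt g (k t) t)
    {f' k' : ℝ} (hf' : HasDerivAt f f' t) (hk' : HasDerivAt k k' t) (x : Plane) :
    dt (multiplierDensity a c V f g k w₀ w₁) t x =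
      f t * (elasticOp₀ a c w₀ w₁ t x * dt w₀ t x + elasticOp₁ a c w₀ w₁ t x * dt w₁ t x +
        elasticForm a c w₀ w₁ (dt w₀) (dt w₁) t x) +
      g t * (elasticOp₀ a c w₀ w₁ t x * w₀ t x + elasticOp₁ a c w₀ w₁ t x * w₁ t x +
        elasticForm a c w₀ w₁ w₀ w₁ t x) +
      (f' / 2 + g t - f t * V x) * (dt w₀ t x ^ 2 + dt w₁ t x ^ 2) +
      (f' / 2 - g t) * elasticForm a c w₀ w₁ w₀ w₁ t x +
      1 / 2 * (k t * V x - k') * (w₀ t x ^ 2 + w₁ t x ^ 2) := by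
  have h0 := h.smooth₀
  have h1 := h.smooth₁
  have hp := (h0.mul h0.dt).add (h1.mul h1.dt)
  have hw := (h0.mul h0).add (h1.mul h1)
  have hft := SmoothEvolution.of_time hf
  have hgt := SmoothEvolution.of_time hg
  have hkt := SmoothEvolution.of_time hk
  have hVs := SmoothEvolution.of_space hV
  have hE := h.smoothEvolution_elasticDensity
  have hz := (hgt.mul hVs).sub hkt
  rw [multiplierDensity, SmoothEvolution.dt_add (((hft.mul hE).smul _).add (hgt.mul hp))
    ((hz.mul hw).smul _) ht, ((hft.mul hE).smul _).dt_add (hgt.mul hp) ht,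
    (hft.mul hE).dt_smul _ ht, hft.dt_mul hE ht, hgt.dt_mul hp ht, (hz.mul hw).dt_smul _ ht,
    hz.dt_mul hw ht, (hgt.mul hVs).dt_sub hkt ht, hgt.dt_mul hVs ht, dt_of_space,
    dt_of_time ht.le hf', dt_of_time ht.le hgk, dt_of_time ht.le hk', h.dt_elasticDensity ht,
    (h0.mul h0.dt).dt_add (h1.mul h1.dt) ht, (h0.mul h0).dt_add (h1.mul h1) ht,
    h0.dt_mul h0.dt ht, h1.dt_mul h1.dt ht, dt_sq h0 ht, dt_sq h1 ht, h.eqn₀ t ht, h.eqn₁ t ht,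
    elasticDensity_apply, elasticOp₀, elasticOp₁]
  simp only [Pi.add_apply, Pi.sub_apply, Pi.mul_apply]
  ring

/-- The primitive U satisfies the equation with the time-independent source `forcing`. Testing with
U_t = w leaves a flux divergence and the dissipation V |w|²; the source is absorbed by -F·U in the
density. -/
theorem dt_primitiveDensity (h : ElasticSystem a c V w₀ w₁) (hV : ContDiff ℝ ∞ V) {t : ℝ}
    (ht : 0 < t) (x : Plane) :
    dt (primitiveDensity a c V w₀ w₁) t x =
      elasticOp₀ a c (primitive w₀) (primitive w₁) t x * w₀ t x +
      elasticOp₁ a c (primitive w₀) (primitive w₁) t x * w₁ t x +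
      elasticForm a c (primitive w₀) (primitive w₁) w₀ w₁ t x -
      V x * (w₀ t x ^ 2 + w₁ t x ^ 2) := by
  have h0 := h.smooth₀
  have h1 := h.smooth₁
  have hU₀ := h.smooth₀.primitive
  have hU₁ := h.smooth₁.primitive
  have hw := (h0.mul h0).add (h1.mul h1)
  have hF₀ := SmoothEvolution.of_space (contDiff_forcing hV h0)
  have hF₁ := SmoothEvolution.of_space (contDiff_forcing hV h1)
  have hQ := hU₀.elasticForm (a := a) (c := c) hU₁ hU₀ hU₁
  have hform : elasticForm a c (primitive w₀) (primitive w₁) (dt (primitive w₀))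
      (dt (primitive w₁)) t x = elasticForm a c (primitive w₀) (primitive w₁) w₀ w₁ t x := by
    simp only [elasticForm_apply, h0.dx_dt_primitive _ ht.le, h1.dx_dt_primitive _ ht.le]
  rw [primitiveDensity, SmoothEvolution.dt_sub ((hw.smul _).add (hQ.smul _))
    ((hF₀.mul hU₀).add (hF₁.mul hU₁)) ht, (hw.smul _).dt_add (hQ.smul _) ht, hw.dt_smul _ ht,
    hQ.dt_smul _ ht, (h0.mul h0).dt_add (h1.mul h1) ht, dt_sq h0 ht, dt_sq h1 ht,
    dt_elasticForm_self hU₀ hU₁ ht, (hF₀.mul hU₀).dt_add (hF₁.mul hU₁) ht, hF₀.dt_mul hU₀ ht,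
    hF₁.dt_mul hU₁ ht, dt_of_space, dt_of_space, h0.dt_primitive ht.le, h1.dt_primitive ht.le,
    h.dt_eq_integrated₀ hV ht.le, h.dt_eq_integrated₁ hV ht.le, hform]
  ring

end ElasticSystem

/-! ### Power weights and lower bounds for the two energies -/

theorem hasDerivAt_add_rpow (q : ℝ) {κ t : ℝ} (h : 0 < t + κ) :
    HasDerivAt (fun s => (s + κ) ^ q) (q * (t + κ) ^ (q - 1)) t := by
  refine (((hasDerivAt_id t).add_const κ).rpow_const (p := q) (Or.inl h.ne')).congr_deriv ?_
  simp

theorem contDiffOn_add_rpow (q : ℝ) {κ : ℝ} (hκ : 0 < κ) :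
    ContDiffOn ℝ ∞ (fun s : ℝ => (s + κ) ^ q) (Ici 0) :=
  (contDiffOn_id.add contDiffOn_const).rpow_const_of_ne fun _ hs =>
    (add_pos_of_nonneg_of_pos hs hκ).ne'

/-- Coercivity of the multiplier quadratic form. -/
theorem multiplier_coercive {r τ β m p w : ℝ} (hr : 0 ≤ r) (hβ : 0 ≤ β) (hm : 0 < m) :
    (1 / 2 - β / (2 * m)) * (r * τ ^ 2 * p ^ 2) ≤
      1 / 2 * (r * τ ^ 2 * p ^ 2) + β * (r * τ) * (w * p) + 1 / 2 * (β * r * m) * w ^ 2 := by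
  have h : 0 ≤ r * (β / (2 * m)) * (τ * p + m * w) ^ 2 := by positivity
  have e : r * (β / (2 * m)) * (τ * p + m * w) ^ 2 = β / (2 * m) * (r * τ ^ 2 * p ^ 2) +
      β * (r * τ) * (w * p) + 1 / 2 * (β * r * m) * w ^ 2 := by
    field_simp; ring
  linarith

/-- Young's inequality, with weights matching the Hardy inequality and a free parameter `l` to tune
against its constant. -/
theorem mul_le_weighted {l F U q : ℝ} (hl : 0 < l) (hq : 0 < q) :
    F * U ≤ l * (U ^ 2 / q ^ 2) + 1 / (4 * l) * (F ^ 2 * q ^ 2) := by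
  have h : 0 ≤ l * (U / q - F * q / (2 * l)) ^ 2 := by positivity
  have e : l * (U / q - F * q / (2 * l)) ^ 2 =
      l * (U ^ 2 / q ^ 2) + 1 / (4 * l) * (F ^ 2 * q ^ 2) - F * U := by
    field_simp; ring
  linarith

/-- Lower bound for the integrated energy of the time primitive, with logarithmic loss. -/
theorem integral_forcing_le {a R : ℝ} (ha : 0 < a) (hR : 0 ≤ R) {F U : Plane → ℝ}
    (hF : Continuous F) {K : Set Plane} (hK : IsCompact K) (hFK : ∀ x ∉ K, F x = 0)
    (hU : ContDiff ℝ 1 U) (hU0 : ∀ x, R < ‖x‖ → U x = 0) :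
    ∫ x, (F x * U x - a ^ 2 / 2 *
        (fderiv ℝ U x (coordVec 0) ^ 2 + fderiv ℝ U x (coordVec 1) ^ 2)) ≤
      (1 + Real.log (1 + (R + 1) ^ 2)) * (1 / (8 * a ^ 2) * ∫ x, F x ^ 2 * weight x ^ 2) := by
  set A := 1 + Real.log (1 + (R + 1) ^ 2) with hA
  have hApos : 0 < A := by
    have := Real.log_nonneg (show 1 ≤ 1 + (R + 1) ^ 2 by nlinarith)
    linarith
  have hB : IsCompact (Metric.closedBall (0 : Plane) R) := isCompact_closedBall _ _
  have hUB : ∀ x ∉ Metric.closedBall (0 : Plane) R, U x = 0 := fun x hx =>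
    hU0 x (by simpa using hx)
  have hUc : ∀ v, Continuous fun x => fderiv ℝ U x v := fun v =>
    (hU.continuous_fderiv one_ne_zero).clm_apply continuous_const
  have hgi : Integrable fun x =>
      fderiv ℝ U x (coordVec 0) ^ 2 + fderiv ℝ U x (coordVec 1) ^ 2 :=
    integrable_of_vanish (((hUc _).pow 2).add ((hUc _).pow 2)) hB
      fun x hx => by simp [fderiv_eq_zero_of_vanish hB.isClosed hUB hx]
  have hFUi : Integrable fun x => F x * U x :=
    integrable_of_vanish (hF.mul hU.continuous) hB fun x hx => by simp [hUB x hx]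
  have hqi : Integrable fun x => U x ^ 2 / weight x ^ 2 :=
    integrable_of_vanish ((hU.continuous.pow 2).div (contDiff_weight.continuous.pow 2)
      fun x => (pow_pos (weight_pos x) 2).ne') hB fun x hx => by simp [hUB x hx]
  have hFi : Integrable fun x => F x ^ 2 * weight x ^ 2 :=
    integrable_of_vanish ((hF.pow 2).mul (contDiff_weight.continuous.pow 2)) hK
      fun x hx => by simp [hFK x hx]
  -- With l = 2a²/A, Hardy's constant A/4 turns the U² term into exactly a²/2 times the gradient
  -- integral. The logarithm survives only in front of the F² integral, as 1/(4l) = A/(8a²).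
  have hl : 0 < 2 * a ^ 2 / A := by positivity
  have h1 : ∫ x, F x * U x ≤ 2 * a ^ 2 / A * (∫ x, U x ^ 2 / weight x ^ 2) +
      1 / (4 * (2 * a ^ 2 / A)) * ∫ x, F x ^ 2 * weight x ^ 2 := by
    rw [← integral_const_mul, ← integral_const_mul,
      ← integral_add (hqi.const_mul _) (hFi.const_mul _)]
    exact integral_mono hFUi ((hqi.const_mul _).add (hFi.const_mul _))
      fun x => mul_le_weighted hl (weight_pos x)
  have h2 := mul_le_mul_of_nonneg_left (integral_sq_div_weight_le hU hR hU0) hl.le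
  rw [← hA] at h2
  rw [integral_sub hFUi (hgi.const_mul _), integral_const_mul]
  have e1 : ∀ I : ℝ, 2 * a ^ 2 / A * (A / 4 * I) = a ^ 2 / 2 * I := fun I => by
    field_simp; ring
  have e2 : 1 / (4 * (2 * a ^ 2 / A)) = A * (1 / (8 * a ^ 2)) := by field_simp; ring
  rw [e1] at h2
  rw [e2] at h1
  linarith

/-! ### Weighted energy inequality -/

namespace ElasticSystem

variable {a b c L κ μ q : ℝ} {V : Plane → ℝ} {w₀ w₁ : ℝ → Plane → ℝ}

/-- The multiplier identity with `f = (t + κ)^q` yields an integrated energy inequality. -/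
theorem integral_functional_le (h : ElasticSystem a c V w₀ w₁) (hb : 0 ≤ b)
    (hV : ContDiff ℝ ∞ V) (hκ : 0 < κ) (hq1 : 1 ≤ q) (hq2 : q ≤ 2) (hqμ : q ≤ μ)
    (hlow : ∀ t, 0 ≤ t → ∀ x, ‖x‖ ≤ L + b * t → μ ≤ V x * (t + κ))
    (hw₀ : FarZero L b w₀) (hw₁ : FarZero L b w₁) {T : ℝ} (hT : 0 ≤ T) :
    ∫ x, (multiplierDensity a c V (fun t => (t + κ) ^ q) (fun t => q / 2 * (t + κ) ^ (q - 1))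
        (fun t => q / 2 * ((q - 1) * (t + κ) ^ (q - 2))) w₀ w₁ +
        κ ^ (q - 2) • primitiveDensity a c V w₀ w₁) T x ≤
    ∫ x, (multiplierDensity a c V (fun t => (t + κ) ^ q) (fun t => q / 2 * (t + κ) ^ (q - 1))
        (fun t => q / 2 * ((q - 1) * (t + κ) ^ (q - 2))) w₀ w₁ +
        κ ^ (q - 2) • primitiveDensity a c V w₀ w₁) 0 x := by
  have h0 := h.smooth₀
  have h1 := h.smooth₁
  have hf := contDiffOn_add_rpow q hκ
  have hg : ContDiffOn ℝ ∞ (fun t : ℝ => q / 2 * (t + κ) ^ (q - 1)) (Ici 0) :=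
    contDiffOn_const.mul (contDiffOn_add_rpow (q - 1) hκ)
  have hk : ContDiffOn ℝ ∞ (fun t : ℝ => q / 2 * ((q - 1) * (t + κ) ^ (q - 2))) (Ici 0) :=
    contDiffOn_const.mul (contDiffOn_const.mul (contDiffOn_add_rpow (q - 2) hκ))
  have hM := h.smoothEvolution_multiplierDensity hV hf hg hk
  have hP := h.smoothEvolution_primitiveDensity hV
  have hft := SmoothEvolution.of_time hf
  have hgt := SmoothEvolution.of_time hg
  have hA₀ := h0.flux₀ (a := a) (c := c) h1 h0.dt h1.dt
  have hA₁ := h0.flux₁ (a := a) (c := c) h1 h0.dt h1.dt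
  have hB₀ := h0.flux₀ (a := a) (c := c) h1 h0 h1
  have hB₁ := h0.flux₁ (a := a) (c := c) h1 h0 h1
  have hC₀ := h0.primitive.flux₀ (a := a) (c := c) h1.primitive h0 h1
  have hC₁ := h0.primitive.flux₁ (a := a) (c := c) h1.primitive h0 h1
  have hout : ∀ {t}, t ∈ Icc 0 T → ∀ {x : Plane}, x ∉ Metric.closedBall 0 (L + b * T) →
      L + b * t < ‖x‖ := fun ht x hx => by
    have : L + b * T < ‖x‖ := by simpa using hx
    nlinarith [ht.2]
  have hdw₀ : ∀ j, FarZero L b (dx j w₀) := hw₀.dx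
  have hdw₁ : ∀ j, FarZero L b (dx j w₁) := hw₁.dx
  refine integral_le_integral_initial (K := Metric.closedBall 0 (L + b * T))
    (h₀ := (fun t _ => (t + κ) ^ q) * flux₀ a c w₀ w₁ (dt w₀) (dt w₁) +
      (fun t _ => q / 2 * (t + κ) ^ (q - 1)) * flux₀ a c w₀ w₁ w₀ w₁ +
      κ ^ (q - 2) • flux₀ a c (primitive w₀) (primitive w₁) w₀ w₁)
    (h₁ := (fun t _ => (t + κ) ^ q) * flux₁ a c w₀ w₁ (dt w₀) (dt w₁) +
      (fun t _ => q / 2 * (t + κ) ^ (q - 1)) * flux₁ a c w₀ w₁ w₀ w₁ +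
      κ ^ (q - 2) • flux₁ a c (primitive w₀) (primitive w₁) w₀ w₁)
    (hM.add (hP.smul _)) (((hft.mul hA₀).add (hgt.mul hB₀)).add (hC₀.smul _))
    (((hft.mul hA₁).add (hgt.mul hB₁)).add (hC₁.smul _)) hT (isCompact_closedBall _ _)
    ?_ ?_ ?_ ?_
  · intro t ht x hx
    have hx' := hout ht hx
    simp [multiplierDensity_apply, primitiveDensity_apply, elasticDensity_apply,
      elasticForm_apply, hw₀ t ht.1 x hx', hw₁ t ht.1 x hx', hw₀.dt t ht.1 x hx',
      hw₁.dt t ht.1 x hx', hdw₀ _ t ht.1 x hx', hdw₁ _ t ht.1 x hx',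
      hw₀.primitive hb t ht.1 x hx', hw₁.primitive hb t ht.1 x hx',
      (hw₀.primitive hb).dx _ t ht.1 x hx', (hw₁.primitive hb).dx _ t ht.1 x hx']
  · intro t ht x hx
    have hx' := hout ht hx
    simp [flux₀_apply, hw₀ t ht.1 x hx', hw₁ t ht.1 x hx', hw₀.dt t ht.1 x hx',
      hw₁.dt t ht.1 x hx']
  · intro t ht x hx
    have hx' := hout ht hx
    simp [flux₁_apply, hw₀ t ht.1 x hx', hw₁ t ht.1 x hx', hw₀.dt t ht.1 x hx',
      hw₁.dt t ht.1 x hx']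
  · intro t ht x
    have ht0 := ht.1
    have hτ : 0 < t + κ := by linarith
    have hg' : HasDerivAt (fun t : ℝ => q / 2 * (t + κ) ^ (q - 1))
        (q / 2 * ((q - 1) * (t + κ) ^ (q - 2))) t := by
      refine ((hasDerivAt_add_rpow (q - 1) hτ).const_mul (q / 2)).congr_deriv ?_
      rw [show q - 1 - 1 = q - 2 by ring]
    have hk' : HasDerivAt (fun t : ℝ => q / 2 * ((q - 1) * (t + κ) ^ (q - 2)))
        (q / 2 * ((q - 1) * ((q - 2) * (t + κ) ^ (q - 3)))) t := by
      refine (((hasDerivAt_add_rpow (q - 2) hτ).const_mul (q - 1)).const_mul (q / 2)).congr_deriv ?_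
      rw [show q - 2 - 1 = q - 3 by ring]
    have hdA := divergence_flux (a := a) (c := c) h0 h1 h0.dt h1.dt ht0 x
    have hdB := divergence_flux (a := a) (c := c) h0 h1 h0 h1 ht0 x
    have hdC := divergence_flux (a := a) (c := c) h0.primitive h1.primitive h0 h1 ht0 x
    rw [hM.dt_add (hP.smul _) ht0, hP.dt_smul _ ht0,
      h.dt_multiplierDensity hV hf hg hk ht0 hg' (hasDerivAt_add_rpow q hτ) hk',
      h.dt_primitiveDensity hV ht0,
      SmoothEvolution.dx_add ((hft.mul hA₀).add (hgt.mul hB₀)) (hC₀.smul _) _ ht0,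
      SmoothEvolution.dx_add ((hft.mul hA₁).add (hgt.mul hB₁)) (hC₁.smul _) _ ht0,
      (hft.mul hA₀).dx_add (hgt.mul hB₀) _ ht0, (hft.mul hA₁).dx_add (hgt.mul hB₁) _ ht0,
      hft.dx_mul hA₀ _ ht0, hft.dx_mul hA₁ _ ht0, hgt.dx_mul hB₀ _ ht0, hgt.dx_mul hB₁ _ ht0,
      hC₀.dx_smul _ _ ht0, hC₁.dx_smul _ _ ht0, dx_of_time, dx_of_time, dx_of_time, dx_of_time,
      ← hdA, ← hdB]
    have hdC' := congrArg (fun r => κ ^ (q - 2) * r) hdC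
    beta_reduce at hdC'
    set r := (t + κ) ^ (q - 2) with hr
    have hr0 : 0 < r := Real.rpow_pos_of_pos hτ _
    have e1 : (t + κ) ^ (q - 1) = r * (t + κ) := by
      rw [hr, ← Real.rpow_add_one hτ.ne']; congr 1; ring
    have e2 : (t + κ) ^ q = r * (t + κ) ^ 2 := by
      rw [hr, ← Real.rpow_add_natCast hτ.ne']; congr 1; push_cast; ring
    have e3 : (t + κ) ^ (q - 3) = r / (t + κ) := by
      rw [hr, ← Real.rpow_sub_one hτ.ne']; congr 1; ring
    -- Since q ≤ 2 the power is largest at t = 0, so one constant multiple of the primitive energy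
    -- suffices for all times.
    have hrκ : r ≤ κ ^ (q - 2) :=
      Real.rpow_le_rpow_of_nonpos hκ (by linarith) (by linarith)
    rw [e1, e2, e3]
    -- What is left after the divergences. The elastic form is absent because g = f'/2; the w_t
    -- coefficient is r (t + κ) (q - V (t + κ)).
    have hmain : (q * (r * (t + κ)) / 2 + q / 2 * (r * (t + κ)) - r * (t + κ) ^ 2 * V x) *
        (dt w₀ t x ^ 2 + dt w₁ t x ^ 2) +
        (1 / 2 * (q / 2 * ((q - 1) * r) * V x - q / 2 * ((q - 1) * ((q - 2) * (r / (t + κ))))) -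
          κ ^ (q - 2) * V x) * (w₀ t x ^ 2 + w₁ t x ^ 2) ≤ 0 := by
      rcases le_or_gt ‖x‖ (L + b * t) with hx | hx
      · have hVx := hlow t ht0.le x hx
        have hV0 : 0 < V x := by
          refine pos_of_mul_pos_left (lt_of_lt_of_le (by linarith) hVx) hτ.le
        refine add_nonpos (mul_nonpos_of_nonpos_of_nonneg ?_ (by positivity))
          (mul_nonpos_of_nonpos_of_nonneg ?_ (by positivity))
        · have : r * (t + κ) * q ≤ r * (t + κ) * (V x * (t + κ)) := by
            have : q ≤ V x * (t + κ) := hqμ.trans hVx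
            gcongr
          linarith
        -- From V (t + κ) ≥ 1 and 0 ≤ 2 - q ≤ 1, the term from k' is controlled by r V; with q (q -
        -- 1)/2 ≤ 1 the total is at most r V ≤ κ^(q-2) V.
        · have hdiv : r / (t + κ) ≤ r * V x := by
            rw [div_le_iff₀ hτ, mul_assoc]
            exact le_mul_of_one_le_right hr0.le (by linarith)
          have hcoef : q / 2 * (q - 1) ≤ 1 := by nlinarith
          have hcoef0 : 0 ≤ q / 2 * (q - 1) := mul_nonneg (by linarith) (by linarith)
          have hs : r * V x + (2 - q) * (r / (t + κ)) ≤ 2 * (r * V x) := by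
            have hnn : 0 ≤ r / (t + κ) := by positivity
            nlinarith
          have hrV : 0 ≤ r * V x := by positivity
          have hs2 : q / 2 * (q - 1) * (r * V x + (2 - q) * (r / (t + κ))) ≤ 1 * (2 * (r * V x)) :=
            mul_le_mul hcoef hs (add_nonneg hrV
              (mul_nonneg (by linarith) (by positivity))) one_pos.le
          have hs3 : r * V x ≤ κ ^ (q - 2) * V x := by gcongr
          linarith
      · simp [hw₀ t ht0.le x hx, hw₁ t ht0.le x hx, hw₀.dt t ht0.le x hx, hw₁.dt t ht0.le x hx]
    linarith

end ElasticSystem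

namespace ElasticSystem

variable {a b c L κ μ q : ℝ} {V : Plane → ℝ} {w₀ w₁ : ℝ → Plane → ℝ}

/-- Pointwise coercivity of the multiplier density where `V (t + κ) ≥ μ > q`. -/
theorem le_multiplierDensity (hc : 0 ≤ c) (hκ : 0 < κ) (hq1 : 1 ≤ q) (hqμ : q < μ)
    {t : ℝ} (ht : 0 ≤ t) {x : Plane} (hlow : μ ≤ V x * (t + κ)) :
    (1 / 2 - q / 2 / (2 * (μ - q + 1))) * ((t + κ) ^ q * elasticDensity a c w₀ w₁ t x) ≤
      multiplierDensity a c V (fun t => (t + κ) ^ q) (fun t => q / 2 * (t + κ) ^ (q - 1))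
        (fun t => q / 2 * ((q - 1) * (t + κ) ^ (q - 2))) w₀ w₁ t x := by
  have hτ : 0 < t + κ := by linarith
  -- From V (t + κ) ≥ μ, the coefficient g V - k is at least (q/2) (t + κ)^(q-2) (μ - (q - 1)),
  -- which fixes the parameter m of `multiplier_coercive`.
  have hm : 0 < μ - q + 1 := by linarith
  rw [multiplierDensity_apply, elasticDensity_apply]
  set r := (t + κ) ^ (q - 2) with hr
  have hr0 : 0 < r := Real.rpow_pos_of_pos hτ _
  have e1 : (t + κ) ^ (q - 1) = r * (t + κ) := by
    rw [hr, ← Real.rpow_add_one hτ.ne']; congr 1; ring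
  have e2 : (t + κ) ^ q = r * (t + κ) ^ 2 := by
    rw [hr, ← Real.rpow_add_natCast hτ.ne']; congr 1; push_cast; ring
  rw [e1, e2]
  have hc0 := multiplier_coercive (τ := t + κ) (p := dt w₀ t x) (w := w₀ t x) hr0.le
    (show 0 ≤ q / 2 by linarith) hm
  have hc1 := multiplier_coercive (τ := t + κ) (p := dt w₁ t x) (w := w₁ t x) hr0.le
    (show 0 ≤ q / 2 by linarith) hm
  have hB := elasticForm_self_nonneg (a := a) (w₀ := w₀) (w₁ := w₁) hc t x
  have hθ : 0 ≤ q / 2 / (2 * (μ - q + 1)) * (r * (t + κ) ^ 2 *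
      elasticForm a c w₀ w₁ w₀ w₁ t x) := by
    have : 0 ≤ q / 2 := by linarith
    positivity
  have hVw : q / 2 * r * μ * (w₀ t x ^ 2 + w₁ t x ^ 2) ≤
      q / 2 * r * (V x * (t + κ)) * (w₀ t x ^ 2 + w₁ t x ^ 2) := by
    have : 0 ≤ q / 2 := by linarith
    gcongr
  linarith

/-- The functional at time `T` is at most its initial value. From below it dominates the weighted
energy minus the integral of F·U - (a²/2) |∇U|², and since U is supported in radius L + bT,
`integral_forcing_le` bounds that integral with a logarithm. -/
theorem weighted_energy_bound (h : ElasticSystem a c V w₀ w₁) (ha : 0 < a) (hc : 0 ≤ c)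
    (hb : 0 ≤ b) (hL : 0 ≤ L) (hV : ContDiff ℝ ∞ V) (hκ : 0 < κ) (hq1 : 1 ≤ q) (hq2 : q ≤ 2)
    (hqμ : q < μ) (hlow : ∀ t, 0 ≤ t → ∀ x, ‖x‖ ≤ L + b * t → μ ≤ V x * (t + κ))
    (hw₀ : FarZero L b w₀) (hw₁ : FarZero L b w₁) :
    ∃ C₁ C₂ : ℝ, ∀ T, 0 ≤ T → (T + κ) ^ q * ∫ x, elasticDensity a c w₀ w₁ T x ≤
      C₁ + C₂ * (1 + Real.log (1 + (L + b * T + 1) ^ 2)) := by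
  set θ := 1 / 2 - q / 2 / (2 * (μ - q + 1)) with hθ
  -- Positive because q/2 ≤ 1 < μ - q + 1.
  have hθ0 : 0 < θ := by
    rw [hθ, sub_pos, div_lt_div_iff₀ (by linarith) two_pos]; linarith
  set e := multiplierDensity a c V (fun t => (t + κ) ^ q) (fun t => q / 2 * (t + κ) ^ (q - 1))
        (fun t => q / 2 * ((q - 1) * (t + κ) ^ (q - 2))) w₀ w₁ with he
  set M := ∫ x, (e + κ ^ (q - 2) • primitiveDensity a c V w₀ w₁) 0 x with hM
  set N := 1 / (8 * a ^ 2) * ∫ x, forcing V w₀ x ^ 2 * weight x ^ 2 with hN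
  set N' := 1 / (8 * a ^ 2) * ∫ x, forcing V w₁ x ^ 2 * weight x ^ 2 with hN'
  refine ⟨M / θ, κ ^ (q - 2) * (N + N') / θ, fun T hT => ?_⟩
  have hle := h.integral_functional_le hb hV hκ hq1 hq2 hqμ.le hlow hw₀ hw₁ hT
  rw [← he, ← hM] at hle
  set A := 1 + Real.log (1 + (L + b * T + 1) ^ 2) with hA
  set K := Metric.closedBall (0 : Plane) (L + b * T) with hK
  have hKc : IsCompact K := isCompact_closedBall _ _
  have hout : ∀ x ∉ K, L + b * T < ‖x‖ := fun x hx => by simpa [hK] using hx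
  have hκq : 0 < κ ^ (q - 2) := Real.rpow_pos_of_pos hκ _
  let J : (ℝ → Plane → ℝ) → Plane → ℝ := fun w x =>
    forcing V w x * primitive w T x - a ^ 2 / 2 *
      (fderiv ℝ (primitive w T) x (coordVec 0) ^ 2 + fderiv ℝ (primitive w T) x (coordVec 1) ^ 2)
  have hJ : ∀ {w}, SmoothEvolution w → FarZero L b w → Integrable (J w) ∧
      ∫ x, J w x ≤ A * (1 / (8 * a ^ 2) * ∫ x, forcing V w x ^ 2 * weight x ^ 2) := by
    intro w hw hfar
    have hF := (contDiff_forcing hV hw).continuous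
    have hU := (hw.primitive.contDiff_slice hT).of_le
      (show (1 : WithTop ℕ∞) ≤ ∞ by exact_mod_cast le_top)
    have hUc : ∀ v, Continuous fun x => fderiv ℝ (primitive w T) x v := fun v =>
      (hU.continuous_fderiv one_ne_zero).clm_apply continuous_const
    have hU0 := hfar.primitive hb T hT
    refine ⟨integrable_of_vanish ((hF.mul hU.continuous).sub
      (continuous_const.mul (((hUc _).pow 2).add ((hUc _).pow 2)))) hKc fun x hx => ?_,
      integral_forcing_le ha (by positivity) hF
        (isCompact_closedBall (0 : Plane) L) (fun x hx => ?_) hU hU0⟩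
    · have hd := fderiv_eq_zero_of_vanish hKc.isClosed (fun y hy => hU0 y (hout y hy)) hx
      simp [J, hU0 x (hout x hx), hd]
    · have hx' : L + b * 0 < ‖x‖ := by simpa using hx
      simp [forcing, hfar 0 le_rfl x hx', hfar.dt 0 le_rfl x hx']
  obtain ⟨hJ₀i, hJ₀⟩ := hJ h.smooth₀ hw₀
  obtain ⟨hJ₁i, hJ₁⟩ := hJ h.smooth₁ hw₁
  have hρ0 : ∀ x ∉ K, elasticDensity a c w₀ w₁ T x = 0 := fun x hx => by
    have hx' := hout x hx
    simp [elasticDensity_apply, elasticForm_apply, hw₀.dt T hT x hx', hw₁.dt T hT x hx',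
      hw₀.dx _ T hT x hx', hw₁.dx _ T hT x hx']
  have hρi : Integrable (elasticDensity a c w₀ w₁ T) :=
    integrable_of_vanish (h.smoothEvolution_elasticDensity.continuous_slice hT) hKc hρ0
  have hes : SmoothEvolution e := h.smoothEvolution_multiplierDensity hV
    (contDiffOn_add_rpow q hκ) (contDiffOn_const.mul (contDiffOn_add_rpow (q - 1) hκ))
    (contDiffOn_const.mul (contDiffOn_const.mul (contDiffOn_add_rpow (q - 2) hκ)))
  have he0 : ∀ x ∉ K, e T x = 0 := fun x hx => by
    have hx' := hout x hx
    simp [he, multiplierDensity_apply, hρ0 x hx, hw₀ T hT x hx', hw₁ T hT x hx']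
  have hei : Integrable ((e + κ ^ (q - 2) • primitiveDensity a c V w₀ w₁) T) := by
    refine integrable_of_vanish ((hes.add
      ((h.smoothEvolution_primitiveDensity hV).smul _)).continuous_slice hT) hKc fun x hx => ?_
    have hx' := hout x hx
    simp [he0 x hx, primitiveDensity_apply, elasticForm_apply, hw₀ T hT x hx', hw₁ T hT x hx',
      hw₀.primitive hb T hT x hx', hw₁.primitive hb T hT x hx',
      (hw₀.primitive hb).dx _ T hT x hx', (hw₁.primitive hb).dx _ T hT x hx']
  have hpt : ∀ x, θ * (T + κ) ^ q * elasticDensity a c w₀ w₁ T x -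
      κ ^ (q - 2) * (J w₀ x + J w₁ x) ≤
        (e + κ ^ (q - 2) • primitiveDensity a c V w₀ w₁) T x := by
    intro x
    have hmul : θ * ((T + κ) ^ q * elasticDensity a c w₀ w₁ T x) ≤ e T x := by
      by_cases hx : x ∈ K
      · exact le_multiplierDensity hc hκ hq1 hqμ hT (hlow T hT x (by simpa [hK] using hx))
      · rw [he0 x hx, hρ0 x hx]; simp
    -- Only the a² part of the elastic form of U is kept; |w|²/2 and the divergence term are
    -- nonnegative.
    have hprim : -(J w₀ x + J w₁ x) ≤ primitiveDensity a c V w₀ w₁ T x := by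
      rw [primitiveDensity_apply, elasticForm_apply]
      have hdiv := mul_nonneg hc (mul_self_nonneg
        (dx 0 (primitive w₀) T x + dx 1 (primitive w₁) T x))
      simp only [J]
      simp only [dx] at hdiv ⊢
      nlinarith [mul_self_nonneg (w₀ T x), mul_self_nonneg (w₁ T x)]
    have hprim' := mul_le_mul_of_nonneg_left hprim hκq.le
    simp only [Pi.add_apply, Pi.smul_apply, smul_eq_mul]
    linarith
  have hint := integral_mono ((hρi.const_mul (θ * (T + κ) ^ q)).sub
    ((hJ₀i.add hJ₁i).const_mul (κ ^ (q - 2)))) hei hpt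
  have hsplit : ∫ x, (θ * (T + κ) ^ q * elasticDensity a c w₀ w₁ T x -
      κ ^ (q - 2) * (J w₀ x + J w₁ x)) = θ * (T + κ) ^ q * (∫ x, elasticDensity a c w₀ w₁ T x) -
      κ ^ (q - 2) * ((∫ x, J w₀ x) + ∫ x, J w₁ x) := by
    rw [← integral_add hJ₀i hJ₁i, ← integral_const_mul, ← integral_const_mul]
    exact integral_sub (hρi.const_mul _) ((hJ₀i.add hJ₁i).const_mul _)
  have hall := (hsplit.symm.le.trans hint).trans hle
  have hJsum := mul_le_mul_of_nonneg_left (add_le_add hJ₀ hJ₁) hκq.le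
  rw [← hN, ← hN'] at hJsum
  have e1 : M / θ + κ ^ (q - 2) * (N + N') / θ * A =
      (M + κ ^ (q - 2) * (A * N + A * N')) / θ := by ring
  rw [e1, le_div_iff₀ hθ0]
  linarith

end ElasticSystem

/-! ### Decay rates -/

theorem isBigO_of_weighted_bound {E : ℝ → ℝ} {L b κ q s C₁ C₂ : ℝ} (hL : 0 ≤ L) (hb : 0 ≤ b)
    (hκ : 0 < κ) (hq : 0 ≤ q) (hs : -q ≤ s) (hE : ∀ T, 0 ≤ T → 0 ≤ E T)
    (hbound : ∀ T, 0 ≤ T → (T + κ) ^ q * E T ≤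
      C₁ + C₂ * (1 + Real.log (1 + (L + b * T + 1) ^ 2))) :
    E =O[atTop] fun t : ℝ => t ^ s * Real.log t := by
  set D := 1 + (L + b + 1) ^ 2 with hD
  have hD1 : 1 ≤ D := by rw [hD]; nlinarith
  refine Asymptotics.IsBigO.of_bound (|C₁| + |C₂| * (1 + Real.log D + 2)) ?_
  -- Beyond e the logarithm is at least 1 and absorbs additive constants.
  filter_upwards [eventually_ge_atTop (Real.exp 1)] with T hT
  have hlog : 1 ≤ Real.log T := (Real.le_log_iff_exp_le ((Real.exp_pos 1).trans_le hT)).2 hT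
  have hT1 : 1 ≤ T := (Real.one_le_exp zero_le_one).trans hT
  have hT0 : 0 < T := by linarith
  have hTκ : 0 < (T + κ) ^ q := Real.rpow_pos_of_pos (by linarith) _
  have hTq : 0 < T ^ q := Real.rpow_pos_of_pos hT0 _
  have hl1 : Real.log (1 + (L + b * T + 1) ^ 2) ≤ Real.log D + 2 * Real.log T := by
    have hle : 1 + (L + b * T + 1) ^ 2 ≤ D * T ^ 2 := by
      have h1 : L + b * T + 1 ≤ (L + b + 1) * T := by nlinarith
      have h2 : (L + b * T + 1) ^ 2 ≤ ((L + b + 1) * T) ^ 2 := by gcongr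
      rw [hD]
      nlinarith
    refine (Real.log_le_log (by positivity) hle).trans_eq ?_
    rw [Real.log_mul (by linarith) (by positivity), Real.log_pow]
    norm_num
  have hl0 : 0 ≤ Real.log (1 + (L + b * T + 1) ^ 2) :=
    Real.log_nonneg (by nlinarith [sq_nonneg (L + b * T + 1)])
  have hDlog : 0 ≤ Real.log D := Real.log_nonneg hD1
  have hmain : T ^ q * E T ≤ (|C₁| + |C₂| * (1 + Real.log D + 2)) * Real.log T := by
    calc T ^ q * E T ≤ (T + κ) ^ q * E T := by
          have := hE T hT0.le
          gcongr
          linarith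
      _ ≤ C₁ + C₂ * (1 + Real.log (1 + (L + b * T + 1) ^ 2)) := hbound T hT0.le
      _ ≤ |C₁| + |C₂| * (1 + Real.log (1 + (L + b * T + 1) ^ 2)) := by
          gcongr <;> exact le_abs_self _
      _ ≤ |C₁| * Real.log T + |C₂| * ((1 + Real.log D + 2) * Real.log T) := by
          gcongr
          · exact le_mul_of_one_le_right (abs_nonneg _) hlog
          · nlinarith
      _ = _ := by ring
  have hsT : T ^ (-q) ≤ T ^ s := Real.rpow_le_rpow_of_exponent_le hT1 hs
  rw [Real.norm_of_nonneg (hE T hT0.le),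
    Real.norm_of_nonneg (mul_nonneg (Real.rpow_nonneg hT0.le _) (by linarith))]
  calc E T = T ^ (-q) * (T ^ q * E T) := by
        rw [← mul_assoc, ← Real.rpow_add hT0]; simp
    _ ≤ T ^ s * ((|C₁| + |C₂| * (1 + Real.log D + 2)) * Real.log T) := by
        have := mul_nonneg hTq.le (hE T hT0.le)
        gcongr
    _ = _ := by ring

end

theorem theorem1p1 (a b : ℝ) (ha : 0 < a) (hab : a < b)
    (V : Plane → ℝ) (V₀ : ℝ) (hV₀ : 0 < V₀)
    (hVsmooth : ContDiff ℝ ∞ V)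
    (hVbdd : ∃ M : ℝ, ∀ x, V x ≤ M)
    (hVlow : ∀ x, V₀ / (1 + ‖x‖) ≤ V x)
    (L : ℝ) (hL : 0 < L)
    (u₀ u₁ : Plane → Plane)
    (hu₀ : ContDiff ℝ ∞ u₀) (hu₁ : ContDiff ℝ ∞ u₁)
    (hsupp : tsupport u₀ ∪ tsupport u₁ ⊆ {x : Plane | ‖x‖ ≤ L})
    (u : ℝ → Plane → Plane) (hu : IsSmoothSolution a b V u₀ u₁ u) :
    (∀ t : ℝ, 0 ≤ t → Integrable (energyDensity a b u t)) ∧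
    (2 * b < V₀ →
      energy a b u =O[atTop] fun t : ℝ => t ^ (-2 : ℝ) * Real.log t) ∧
    (b < V₀ → V₀ ≤ 2 * b → ∀ δ : ℝ, 0 < δ →
      energy a b u =O[atTop] fun t : ℝ => t ^ (-(V₀ / b) + δ) * Real.log t) := by
  have hb : 0 < b := ha.trans hab
  have hc : 0 ≤ b ^ 2 - a ^ 2 := by nlinarith
  have hsys := hu.elasticSystem
  have hVnn : ∀ x, 0 ≤ V x := fun x => le_trans (by positivity) (hVlow x)
  have hu₀z : ∀ x, L < ‖x‖ → u₀ x = 0 := fun x hx =>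
    image_eq_zero_of_notMem_tsupport fun hm => hx.not_ge (hsupp (Or.inl hm))
  have hu₁z : ∀ x, L < ‖x‖ → u₁ x = 0 := fun x hx =>
    image_eq_zero_of_notMem_tsupport fun hm => hx.not_ge (hsupp (Or.inr hm))
  have hinit : ∀ i x, L < ‖x‖ → component u i 0 x = 0 := fun i x hx => by
    rw [component, hu.init_pos, hu₀z x hx]; rfl
  have hvel : ∀ i x, L < ‖x‖ → dt (component u i) 0 x = 0 := fun i x hx => by
    rw [← hu.timeDeriv_apply le_rfl, hu.init_vel, hu₁z x hx]; rfl
  have hfar := fun t ht x hx => hsys.eq_zero_of_far (T := t) (z := x) hc (by ring) hb hVnn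
    (hinit 0) (hinit 1) (hvel 0) (hvel 1) ht hx
  have hw₀ : FarZero L b (component u 0) := fun t ht x hx => (hfar t ht x hx).1
  have hw₁ : FarZero L b (component u 1) := fun t ht x hx => (hfar t ht x hx).2
  have hdens : ∀ t, 0 ≤ t → energyDensity a b u t =
      elasticDensity a (b ^ 2 - a ^ 2) (component u 0) (component u 1) t := by
    intro t ht
    funext x
    rw [hu.energyDensity_eq ht, elasticDensity_apply, elasticForm_apply]
    ring
  have henergy : ∀ t, 0 ≤ t → energy a b u t = 1 / 2 *
      ∫ x, elasticDensity a (b ^ 2 - a ^ 2) (component u 0) (component u 1) t x := by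
    intro t ht
    rw [energy, hdens t ht]
  have henn : ∀ t, 0 ≤ t → 0 ≤ energy a b u t := fun t ht => by
    rw [henergy t ht]
    exact mul_nonneg (by norm_num)
      (integral_nonneg fun x => ElasticSystem.elasticDensity_nonneg hc t x)
  -- This κ gives b (t + κ) = 1 + L + bt ≥ 1 + |x| on the support, so the lower bound on `V` becomes
  -- V (t + κ) ≥ V₀/b.
  have hκ : 0 < (1 + L) / b := by positivity
  have hlow : ∀ t, 0 ≤ t → ∀ x, ‖x‖ ≤ L + b * t → V₀ / b ≤ V x * (t + (1 + L) / b) := by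
    intro t ht x hx
    have hVx := (div_le_iff₀ (by positivity)).1 (hVlow x)
    have h1 : V x * (1 + ‖x‖) ≤ V x * (1 + (L + b * t)) := by
      have := hVnn x
      gcongr
    have h2 : V x * (t + (1 + L) / b) = V x * (1 + (L + b * t)) / b := by field_simp; ring
    rw [h2]
    gcongr
    linarith
  have hdecay : ∀ q s : ℝ, 1 ≤ q → q ≤ 2 → q < V₀ / b → -q ≤ s →
      energy a b u =O[atTop] fun t : ℝ => t ^ s * Real.log t := by
    intro q s hq1 hq2 hqμ hs
    obtain ⟨C₁, C₂, hC⟩ := hsys.weighted_energy_bound ha hc hb.le hL.le hVsmooth hκ hq1 hq2 hqμ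
      hlow hw₀ hw₁
    refine isBigO_of_weighted_bound (C₁ := C₁ / 2) (C₂ := C₂ / 2) hL.le hb.le hκ (by linarith) hs
      henn fun T hT => ?_
    rw [henergy T hT]
    linarith [hC T hT]
  refine ⟨fun t ht => ?_, fun h => ?_, fun h1 h2 δ hδ => ?_⟩
  · rw [hdens t ht]
    refine integrable_of_vanish (hsys.smoothEvolution_elasticDensity.continuous_slice ht)
      (isCompact_closedBall 0 (L + b * t)) fun x hx => ?_
    have hx' : L + b * t < ‖x‖ := by simpa using hx
    simp [elasticDensity_apply, elasticForm_apply, hw₀.dt t ht x hx', hw₁.dt t ht x hx',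
      hw₀.dx _ t ht x hx', hw₁.dx _ t ht x hx']
  · exact hdecay 2 (-2) one_le_two le_rfl ((lt_div_iff₀ hb).2 h) le_rfl
  · have hμ1 : 1 < V₀ / b := (one_lt_div hb).2 h1
    have hμ2 : V₀ / b ≤ 2 := (div_le_iff₀ hb).2 h2
    -- The exponent is q = V₀/b - ε. Here ε > 0 gives q < V₀/b, ε ≤ δ gives the claimed rate, and ε
    -- ≤ (V₀/b - 1)/2 keeps q ≥ 1.
    have hε : 0 < min δ ((V₀ / b - 1) / 2) := lt_min hδ (by linarith)
    have hε1 := min_le_left δ ((V₀ / b - 1) / 2)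
    have hε2 := min_le_right δ ((V₀ / b - 1) / 2)
    exact hdecay (V₀ / b - min δ ((V₀ / b - 1) / 2)) _ (by linarith) (by linarith)
      (by linarith) (by linarith)
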